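/- **Theorem.** There exists a unital $C^*$-algebra $A$ with all of the following properties. 1. $A$ is AF (it has an increasing sequence of finite-dimensional $*$-subalgebras with dense union) and residually finite-dimensional (for each $0\neq a\in A$ there are $n$ and a unital $*$-homomorphism $\theta:A\to M_n(\mathbb C)$ with $\theta(a)\ne 0$). 2. $A$ is not matricially tracially stable: it is not true that for every free ultrafilter $\alpha$ on $\mathbb N$, every sequence $(k_i)$ of positive integers and every unital $*$-homomorphism $\varphi:A\to\prod^{\alpha}_i (M_{k_i}(\mathbb C),\mathrm{tr}_{k_i})$ there are $E\in\alpha$ and unital $*$-homomorphisms $\psi_i:A\to M_{k_i}(\mathbb C)$, $i\in E$, such that, for every $a \in A$, $\varphi(a)$ is the class of $(\psi_i(a))_{i\in E}$. Here $\prod^{\alpha}_i (M_{k_i}(\mathbb C),\mathrm{tr}_{k_i})$ is the tracial ultraproduct, i.e. the quotient of the $C^*$-algebra $\prod_i M_{k_i}(\mathbb C)$ of bounded sequences by the ideal of those $(x_i)$ with $\lim_{i\to\alpha}\mathrm{tr}_{k_i}(x_i^*x_i)=0$, where $\mathrm{tr}_k$ is the normalized trace. Nor is $A$ matricially tracially stable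 in the non-unital category: it is not true that, for all such $\alpha$ and $(k_i)$, every (not necessarily unital) $*$-homomorphism $A\to\prod^{\alpha}_i (M_{k_i}(\mathbb C),\mathrm{tr}_{k_i})$ lifts to a (not necessarily unital) $*$-homomorphism $A\to\prod_i M_{k_i}(\mathbb C)$. 3. $A$ is not $W^*$-$W^*$-projective, neither in the unital nor in the non-unital category: it is not true that for all von Neumann algebras $\mathcal B$ and $\mathcal M\neq 0$, every surjective unital $*$-homomorphism $\pi:\mathcal B\to\mathcal M$ and every unital $*$-homomorphism $\varphi:A\to\mathcal M$ there is a unital $*$-homomorphism $\psi:A\to\mathcal B$ with $\pi\circ\psi=\varphi$; and the same statement with the word "unital" deleted throughout (and $\mathcal M = 0$ allowed) is not true either. 4. There are positive integers $k_i$ $(i\in\mathbb N)$ such that $A$ is (isomorphic to) a unital $C^*$-subalgebra of $\prod_i M_{k_i}(\mathbb C)$ that contains the ideal $\bigoplus_i M_{k_i}(\mathbb C)$ of sequences tending to $0$ in norm, and $A/\bigoplus_i M_{k_i}(\mathbb C)\cong M_{2^\infty}\oplus M_{2^\infty}$, where $M_{2^\infty}$ is the UHF algebra of type $2^\infty$.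 5. $A$ has a tracial state that does not lie in the weak$^*$-closure of the set of finite-dimensional traces, i.e. of the tracial states of the form $\rho\circ\theta$ with $\theta$ a unital $*$-homomorphism from $A$ to a finite-dimensional $C^*$-algebra $B$ and $\rho$ a tracial state on $B$. -/

import Mathlib

noncomputable section

namespace TracialStab

open Filter Topology
open scoped Matrix.Norms.L2Operator ComplexOrder

universe u v

/-- The full matrix algebra `M_n(ℂ)`; its norm is the operator (C*-) norm. -/
abbrev Mat (n : ℕ) : Type := Matrix (Fin n) (Fin n) ℂ

/-- The C*-algebra `∏ M_{k i}(ℂ)` of all norm-bounded sequences of matrices. -/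
def boundedSeq (k : ℕ → ℕ) : StarSubalgebra ℂ (∀ i, Mat (k i)) where
  carrier := {x | ∃ C : ℝ, ∀ i, ‖x i‖ ≤ C}
  mul_mem' := by
    rintro x y ⟨C, hC⟩ ⟨D, hD⟩
    refine ⟨C * D, fun i => (norm_mul_le _ _).trans ?_⟩
    exact mul_le_mul (hC i) (hD i) (norm_nonneg _) ((norm_nonneg _).trans (hC i))
  add_mem' := by
    rintro x y ⟨C, hC⟩ ⟨D, hD⟩
    exact ⟨C + D, fun i => (norm_add_le _ _).trans (add_le_add (hC i) (hD i))⟩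
  algebraMap_mem' := by
    intro r
    refine ⟨‖r‖, fun i => ?_⟩
    have h : (algebraMap ℂ (∀ i, Mat (k i)) r) i = Matrix.diagonal (fun _ => r) := by
      simp [Matrix.algebraMap_eq_diagonal]
    rw [h, Matrix.l2_opNorm_diagonal]
    exact (pi_norm_le_iff_of_nonneg (norm_nonneg _)).2 fun _ => le_rfl
  star_mem' := by
    rintro x ⟨C, hC⟩
    exact ⟨C, fun i => by simpa using hC i⟩

/-- The C*-direct sum `⊕ M_{k i}(ℂ)`: sequences of matrices whose norms tend to zero. -/
def nullSeq (k : ℕ → ℕ) : Set (∀ i, Mat (k i)) :=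
  {x | Tendsto (fun i => ‖x i‖) atTop (𝓝 0)}

/-- `‖x‖₂² = tr_n(x* x)`, where `tr_n` is the normalized trace on `M_n(ℂ)`. -/
def hsSq {n : ℕ} (x : Mat n) : ℝ := (Matrix.trace (star x * x)).re / n

theorem hsSq_eq {n : ℕ} (x : Mat n) : hsSq x = (∑ j, ∑ i, ‖x i j‖ ^ 2) / n := by
  unfold hsSq
  congr 1
  simp only [Matrix.trace, Matrix.diag, Matrix.mul_apply, Matrix.star_apply, Complex.re_sum]
  refine Finset.sum_congr rfl fun j _ => Finset.sum_congr rfl fun i _ => ?_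
  rw [Complex.sq_norm, Complex.normSq_apply]
  simp

theorem hsSq_nonneg {n : ℕ} (x : Mat n) : 0 ≤ hsSq x := by
  rw [hsSq_eq]; positivity

theorem hsSq_star {n : ℕ} (x : Mat n) : hsSq (star x) = hsSq x := by
  rw [hsSq_eq, hsSq_eq, Finset.sum_comm]
  simp [Matrix.star_apply]

theorem hsSq_add_le {n : ℕ} (x y : Mat n) : hsSq (x + y) ≤ 2 * hsSq x + 2 * hsSq y := by
  rw [hsSq_eq, hsSq_eq, hsSq_eq, mul_div_assoc', mul_div_assoc', ← add_div]
  refine div_le_div_of_nonneg_right ?_ (Nat.cast_nonneg n)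
  simp only [Finset.mul_sum, ← Finset.sum_add_distrib]
  refine Finset.sum_le_sum fun j _ => Finset.sum_le_sum fun i _ => ?_
  have h := norm_add_le (x i j) (y i j)
  have h0 := norm_nonneg (x i j + y i j)
  rw [Matrix.add_apply]
  nlinarith [sq_nonneg (‖x i j‖ - ‖y i j‖), mul_self_le_mul_self h0 h]

theorem hsSq_mul_le {n : ℕ} (a x : Mat n) : hsSq (a * x) ≤ ‖a‖ ^ 2 * hsSq x := by
  rw [hsSq_eq, hsSq_eq, mul_div_assoc']
  refine div_le_div_of_nonneg_right ?_ (Nat.cast_nonneg n)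
  rw [Finset.mul_sum]
  refine Finset.sum_le_sum fun j _ => ?_
  have h := Matrix.l2_opNorm_mulVec a (WithLp.toLp 2 (fun i => x i j))
  have h2 := mul_self_le_mul_self (norm_nonneg _) h
  have e1 : ∑ i, ‖(a * x) i j‖ ^ 2 =
      ‖WithLp.toLp 2 (Matrix.mulVec a (fun i => x i j))‖ ^ 2 := by
    rw [EuclideanSpace.norm_sq_eq]
    rfl
  have e2 : ∑ i, ‖x i j‖ ^ 2 = ‖(WithLp.toLp 2 (fun i => x i j) : EuclideanSpace ℂ (Fin n))‖ ^ 2 := by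
    rw [EuclideanSpace.norm_sq_eq]
  rw [e1, e2, ← mul_pow, sq, sq]
  exact h2

theorem hsSq_mul_le' {n : ℕ} (x a : Mat n) : hsSq (x * a) ≤ ‖a‖ ^ 2 * hsSq x := by
  rw [← hsSq_star (x * a), star_mul, ← hsSq_star x, ← norm_star a]
  exact hsSq_mul_le _ _

/-- The ideal of all bounded sequences whose normalized Hilbert-Schmidt norms tend to zero along
the ultrafilter `α`. -/
def traceIdeal (α : Ultrafilter ℕ) (k : ℕ → ℕ) : Ideal (boundedSeq k) where
  carrier := {x | Tendsto (fun i => hsSq (x.1 i)) α (𝓝 0)}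
  zero_mem' := by
    have : (fun i => hsSq ((0 : boundedSeq k).1 i)) = fun _ => 0 := by
      funext i
      simp [hsSq]
    change Tendsto (fun i => hsSq ((0 : boundedSeq k).1 i)) α (𝓝 0)
    rw [this]
    exact tendsto_const_nhds
  add_mem' := by
    intro x y hx hy
    have h : Tendsto (fun i => 2 * hsSq (x.1 i) + 2 * hsSq (y.1 i)) α (𝓝 0) := by
      simpa using (hx.const_mul 2).add (hy.const_mul 2)
    exact squeeze_zero (fun i => hsSq_nonneg _) (fun i => hsSq_add_le _ _) h
  smul_mem' := by
    rintro ⟨a, C, hC⟩ x hx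
    have h : Tendsto (fun i => C ^ 2 * hsSq (x.1 i)) α (𝓝 0) := by
      simpa using hx.const_mul (C ^ 2)
    refine squeeze_zero (fun i => hsSq_nonneg _) (fun i => (hsSq_mul_le _ _).trans ?_) h
    exact mul_le_mul_of_nonneg_right (pow_le_pow_left₀ (norm_nonneg _) (hC i) 2) (hsSq_nonneg _)

theorem mem_traceIdeal {α : Ultrafilter ℕ} {k : ℕ → ℕ} {x : boundedSeq k} :
    x ∈ traceIdeal α k ↔ Tendsto (fun i => hsSq (x.1 i)) α (𝓝 0) := Iff.rfl

instance (α : Ultrafilter ℕ) (k : ℕ → ℕ) : (traceIdeal α k).IsTwoSided where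
  mul_mem_of_left := by
    rintro x ⟨a, C, hC⟩ hx
    have h : Tendsto (fun i => C ^ 2 * hsSq (x.1 i)) α (𝓝 0) := by
      simpa using (mem_traceIdeal.1 hx).const_mul (C ^ 2)
    refine squeeze_zero (fun i => hsSq_nonneg _) (fun i => (hsSq_mul_le' _ _).trans ?_) h
    exact mul_le_mul_of_nonneg_right (pow_le_pow_left₀ (norm_nonneg _) (hC i) 2) (hsSq_nonneg _)

theorem star_mem_traceIdeal {α : Ultrafilter ℕ} {k : ℕ → ℕ} {x : boundedSeq k}
    (hx : x ∈ traceIdeal α k) : star x ∈ traceIdeal α k := by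
  rw [mem_traceIdeal] at hx ⊢
  have : (fun i => hsSq ((star x).1 i)) = fun i => hsSq (x.1 i) := by
    funext i
    exact hsSq_star (x.1 i)
  rwa [this]

/-- The tracial ultraproduct `∏^α (M_{k i}(ℂ), tr_{k i})`, with its *-algebra structure. -/
def TracialUltraproduct (α : Ultrafilter ℕ) (k : ℕ → ℕ) : Type :=
  boundedSeq k ⧸ traceIdeal α k

namespace TracialUltraproduct

instance (α : Ultrafilter ℕ) (k : ℕ → ℕ) : Ring (TracialUltraproduct α k) :=
  inferInstanceAs (Ring (boundedSeq k ⧸ traceIdeal α k))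

instance (α : Ultrafilter ℕ) (k : ℕ → ℕ) : Algebra ℂ (TracialUltraproduct α k) :=
  inferInstanceAs (Algebra ℂ (boundedSeq k ⧸ traceIdeal α k))

/-- The quotient map `∏ M_{k i}(ℂ) → ∏^α (M_{k i}(ℂ), tr_{k i})` as an algebra homomorphism. -/
def mkₐ (α : Ultrafilter ℕ) (k : ℕ → ℕ) : boundedSeq k →ₐ[ℂ] TracialUltraproduct α k :=
  Ideal.Quotient.mkₐ ℂ (traceIdeal α k)

theorem mkₐ_surjective (α : Ultrafilter ℕ) (k : ℕ → ℕ) : Function.Surjective (mkₐ α k) :=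
  Ideal.Quotient.mk_surjective

theorem mkₐ_eq_iff {α : Ultrafilter ℕ} {k : ℕ → ℕ} {x y : boundedSeq k} :
    mkₐ α k x = mkₐ α k y ↔ x - y ∈ traceIdeal α k :=
  Ideal.Quotient.mk_eq_mk_iff_sub_mem x y

instance (α : Ultrafilter ℕ) (k : ℕ → ℕ) : Star (TracialUltraproduct α k) where
  star := Quotient.lift (fun x : boundedSeq k => mkₐ α k (star x)) (by
    intro x y h
    have h' : x - y ∈ traceIdeal α k := (Submodule.quotientRel_def _).1 h
    rw [mkₐ_eq_iff]
    have h2 := star_mem_traceIdeal h'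
    rwa [star_sub x y] at h2)

theorem star_mkₐ (α : Ultrafilter ℕ) (k : ℕ → ℕ) (x : boundedSeq k) :
    star (mkₐ α k x) = mkₐ α k (star x) := rfl

instance (α : Ultrafilter ℕ) (k : ℕ → ℕ) : StarRing (TracialUltraproduct α k) where
  star_involutive := by
    intro a
    obtain ⟨x, rfl⟩ := mkₐ_surjective α k a
    rw [star_mkₐ, star_mkₐ, star_star]
  star_mul := by
    intro a b
    obtain ⟨x, rfl⟩ := mkₐ_surjective α k a
    obtain ⟨y, rfl⟩ := mkₐ_surjective α k b
    rw [← map_mul, star_mkₐ, star_mkₐ, star_mkₐ, star_mul, map_mul]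
  star_add := by
    intro a b
    obtain ⟨x, rfl⟩ := mkₐ_surjective α k a
    obtain ⟨y, rfl⟩ := mkₐ_surjective α k b
    rw [← map_add, star_mkₐ, star_mkₐ, star_mkₐ, star_add, map_add]

instance (α : Ultrafilter ℕ) (k : ℕ → ℕ) : StarModule ℂ (TracialUltraproduct α k) where
  star_smul := by
    intro c a
    obtain ⟨x, rfl⟩ := mkₐ_surjective α k a
    rw [← map_smul, star_mkₐ, star_mkₐ, star_smul, map_smul]

/-- The quotient *-homomorphism `∏ M_{k i}(ℂ) → ∏^α (M_{k i}(ℂ), tr_{k i})`. -/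
def mk (α : Ultrafilter ℕ) (k : ℕ → ℕ) : boundedSeq k →⋆ₐ[ℂ] TracialUltraproduct α k :=
  { mkₐ α k with map_star' := fun x => (star_mkₐ α k x).symm }

end TracialUltraproduct

/-- A unital C*-algebra is AF if it has an increasing sequence of finite-dimensional
*-subalgebras with dense union. -/
def IsAF (A : Type u) [CStarAlgebra A] : Prop :=
  ∃ F : ℕ → StarSubalgebra ℂ A, Monotone F ∧ (∀ n, FiniteDimensional ℂ (F n)) ∧
    Dense (⋃ n, (F n : Set A))

/-- Residually finite-dimensional: finite-dimensional representations separate points. -/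
def IsRFD (A : Type u) [CStarAlgebra A] : Prop :=
  ∀ a : A, a ≠ 0 → ∃ (n : ℕ) (θ : A →⋆ₐ[ℂ] Mat n), θ a ≠ 0

/-- Matricial tracial stability of a unital C*-algebra: every unital *-homomorphism into a tracial
ultraproduct of matrix algebras over a free ultrafilter on `ℕ` is given, for indices in some set
of the ultrafilter, by unital *-homomorphisms into the matrix algebras. -/
def MatriciallyTraciallyStable (A : Type u) [CStarAlgebra A] : Prop :=
  ∀ (α : Ultrafilter ℕ), (α : Filter ℕ) ≤ cofinite → ∀ k : ℕ → ℕ, (∀ i, 0 < k i) →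
    ∀ φ : A →⋆ₐ[ℂ] TracialUltraproduct α k,
      ∃ E ∈ α, ∃ ψ : ∀ i ∈ E, A →⋆ₐ[ℂ] Mat (k i),
        ∀ a : A, ∃ x : boundedSeq k,
          (∀ i (hi : i ∈ E), x.1 i = ψ i hi a) ∧ TracialUltraproduct.mk α k x = φ a

/-- Matricial tracial stability in the non-unital category: every *-homomorphism into a tracial
ultraproduct of matrix algebras over a free ultrafilter on `ℕ` lifts to a *-homomorphism into the
C*-product of these matrix algebras, none of the maps being required to be unital. -/
def MatriciallyTraciallyStableNonUnital (A : Type u) [CStarAlgebra A] : Prop :=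
  ∀ (α : Ultrafilter ℕ), (α : Filter ℕ) ≤ cofinite → ∀ k : ℕ → ℕ, (∀ i, 0 < k i) →
    ∀ φ : A →⋆ₙₐ[ℂ] TracialUltraproduct α k,
      ∃ ψ : A →⋆ₙₐ[ℂ] boundedSeq k, ∀ a, TracialUltraproduct.mk α k (ψ a) = φ a

/-- W*-W*-projectivity (unital category): unital *-homomorphisms into a (nonzero) von Neumann
algebra lift along surjective unital *-homomorphisms from von Neumann algebras. The
*-homomorphisms between von Neumann algebras need not be normal. -/
def WStarWStarProjective (A : Type u) [CStarAlgebra A] : Prop :=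
  ∀ (H K : Type v) [NormedAddCommGroup H] [InnerProductSpace ℂ H] [CompleteSpace H]
    [NormedAddCommGroup K] [InnerProductSpace ℂ K] [CompleteSpace K] [Nontrivial K]
    (B : VonNeumannAlgebra H) (M : VonNeumannAlgebra K)
    (π : B.toStarSubalgebra →⋆ₐ[ℂ] M.toStarSubalgebra), Function.Surjective π →
    ∀ φ : A →⋆ₐ[ℂ] M.toStarSubalgebra,
      ∃ ψ : A →⋆ₐ[ℂ] B.toStarSubalgebra, ∀ a, π (ψ a) = φ a

/-- W*-W*-projectivity in the non-unital category. -/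
def WStarWStarProjectiveNonUnital (A : Type u) [CStarAlgebra A] : Prop :=
  ∀ (H K : Type v) [NormedAddCommGroup H] [InnerProductSpace ℂ H] [CompleteSpace H]
    [NormedAddCommGroup K] [InnerProductSpace ℂ K] [CompleteSpace K]
    (B : VonNeumannAlgebra H) (M : VonNeumannAlgebra K)
    (π : B.toStarSubalgebra →⋆ₙₐ[ℂ] M.toStarSubalgebra), Function.Surjective π →
    ∀ φ : A →⋆ₙₐ[ℂ] M.toStarSubalgebra,
      ∃ ψ : A →⋆ₙₐ[ℂ] B.toStarSubalgebra, ∀ a, π (ψ a) = φ a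

/-- `U` is (isomorphic to) the UHF algebra `M_{2^∞}`: it is the closure of an increasing sequence
of unital *-subalgebras isomorphic to `M_{2^n}(ℂ)`. -/
def IsUHFTwoInfty (U : Type u) [CStarAlgebra U] : Prop :=
  ∃ F : ℕ → StarSubalgebra ℂ U, Monotone F ∧ (∀ n, Nonempty (F n ≃⋆ₐ[ℂ] Mat (2 ^ n))) ∧
    Dense (⋃ n, (F n : Set U))

/-- `A` is a C*-algebra with `⊕ M_{k i}(ℂ) ⊆ A ⊆ ∏ M_{k i}(ℂ)` for some positive integers `k i`,
and `A / ⊕ M_{k i}(ℂ)` is isomorphic to `M_{2^∞} ⊕ M_{2^∞}`. -/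
def IsExtensionOfUHFByMatrices (A : Type u) [CStarAlgebra A] : Prop :=
  ∃ (k : ℕ → ℕ) (j : A →⋆ₐ[ℂ] boundedSeq k) (U : Type u) (_ : CStarAlgebra U)
    (π : A →⋆ₐ[ℂ] U × U),
    (∀ i, 0 < k i) ∧ Function.Injective j ∧
    (∀ x : boundedSeq k, x.1 ∈ nullSeq k → x ∈ Set.range j) ∧
    IsUHFTwoInfty U ∧ Function.Surjective π ∧ ∀ a, π a = 0 ↔ (j a).1 ∈ nullSeq k

/-- Tracial states on a unital C*-algebra, as elements of the dual with the weak* topology. -/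
structure IsTracialState {A : Type u} [CStarAlgebra A] (τ : WeakDual ℂ A) : Prop where
  map_one : τ 1 = 1
  nonneg : ∀ a, 0 ≤ τ (star a * a)
  comm : ∀ a b, τ (a * b) = τ (b * a)

/-- The tracial states that factor through a finite-dimensional C*-algebra. -/
def finDimTraces (A : Type u) [CStarAlgebra A] : Set (WeakDual ℂ A) :=
  {σ | ∃ (B : Type u) (_ : CStarAlgebra B) (_ : FiniteDimensional ℂ B) (θ : A →⋆ₐ[ℂ] B)
    (ρ : WeakDual ℂ B), IsTracialState ρ ∧ ∀ a, σ a = ρ (θ a)}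

end TracialStab

end

/-! Let `U` be the UHF algebra of type 2^∞. The algebra consists of the bounded sequences in ∏
M_{2^i + 2^i} that are asymptotically block diagonal, diag(a_i, b_i), with a_i and b_i in M_{2^i}
converging in `U`. Its quotient by the null sequences is `U × U`. It is AF because finitely many
blocks together with a tail in M_{2^n} ⊕ M_{2^n} span a finite-dimensional subalgebra, and RFD
because it embeds in a product of matrix algebras.

Everything negative comes from the projection p = diag(1, 0), called `corner`. A homomorphism θ into
a finite-dimensional algebra kills the tail copies of M_{2^n} once n is large, since a matrix
algebra has no nonzero homomorphism into an algebra of smaller dimension. On the finitely many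
remaining blocks p and 1 - p are exchanged by a partial isometry w. Hence every trace gives θ(p) and
θ(1 - p) the same weight (`map_corner_eq`), even if θ is not unital.

In a tracial ultraproduct, however, null sequences vanish, so `U × U` maps into it. Preceding this
map by (u, v) ↦ (u, u) gives a unital *-homomorphism with p ↦ 1 (`exists_hom_corner_eq_one`). A lift
would give finite-dimensional representations in which both 1 and p have normalized trace tending to
1, against tr θ(1) = 2 tr θ(p) (`not_tendsto_ntr`). Composing the same homomorphism with the limit
trace gives a tracial state with value 1 at p, whereas weak*-limits of finite-dimensional traces
take the value 1/2 there.

For W*-W*-projectivity the ultraproduct must be a von Neumann algebra and a quotient of one. It is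
realized on the GNS space of the limit trace as the commutant of the right multiplications
(`ultraMk_surjective`), and it is covered by the block diagonal operators on a Hilbert sum
(`blocks_surjective`). -/

noncomputable section

namespace TracialStab

open Filter Topology UniformSpace
open scoped ComplexOrder InnerProductSpace

/-! ### The GNS space of a tracial functional and the commutant of its right multiplications. -/

section TracialGNS

variable {A : Type*} [CStarAlgebra A] [PartialOrder A] [StarOrderedRing A]

/-- Cutting off the large part of `a` by continuous functional calculus. -/
theorem exists_truncation (a : A) {D : ℝ} (hD : 0 ≤ D) :
    ∃ y : A, ‖y‖ ≤ 1 ∧ ‖a * (1 - y)‖ ≤ D + 1 ∧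
      (D ^ 2) • (star y * y) ≤ star (a * y) * (a * y) := by
  -- A continuous cut-off, 0 up to D² and 1 from D² + 1 on; the witness is y = h(a*a).
  set h : ℝ → ℝ := fun t => max 0 (min 1 (t - D ^ 2)) with hh
  have hc : Continuous h := by fun_prop
  set b : A := star a * a with hb
  have hbsa : IsSelfAdjoint b := IsSelfAdjoint.star_mul_self a
  have hb0 : 0 ≤ b := star_mul_self_nonneg a
  have hsp : ∀ t ∈ spectrum ℝ b, 0 ≤ t := fun t ht => spectrum_nonneg_of_nonneg hb0 ht
  have hysa : star (cfc h b) = cfc h b := (cfc_predicate h b : IsSelfAdjoint _).star_eq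
  have hid : cfc (fun t : ℝ => t) b = b := cfc_id' ℝ b
  have hone : (1 : A) - cfc h b = cfc (fun t => 1 - h t) b := by
    rw [cfc_sub (fun _ => (1 : ℝ)) h b, cfc_const_one ℝ b]
  have key : ∀ g : ℝ → ℝ, Continuous g →
      star (a * cfc g b) * (a * cfc g b) = cfc (fun t => g t * (t * g t)) b := by
    intro g hg
    have hgsa : star (cfc g b) = cfc g b := (cfc_predicate g b : IsSelfAdjoint _).star_eq
    rw [cfc_mul g (fun t => t * g t) b (by fun_prop) (by fun_prop),
      cfc_mul (fun t => t) g b (by fun_prop) (by fun_prop), hid, star_mul, hgsa, hb]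
    simp only [mul_assoc]
  refine ⟨cfc h b, ?_, ?_, ?_⟩
  · refine norm_cfc_le zero_le_one fun t _ => ?_
    rw [Real.norm_of_nonneg (le_max_left _ _)]
    exact max_le zero_le_one (min_le_left _ _)
  · rw [hone]
    refine le_of_sq_le_sq ?_ (by positivity)
    rw [sq, ← CStarRing.norm_star_mul_self, key _ (by fun_prop)]
    refine norm_cfc_le (by positivity) fun t ht => ?_
    have ht0 := hsp t ht
    have h0 : 0 ≤ h t := le_max_left _ _
    have h1 : h t ≤ 1 := max_le zero_le_one (min_le_left _ _)
    rw [Real.norm_of_nonneg (by have : 0 ≤ 1 - h t := by linarith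
                                positivity)]
    by_cases hlt : t ≤ D ^ 2 + 1
    -- Below D² + 1 the bound is D² + 1 ≤ (D + 1)²; above it 1 - h vanishes.
    · have : (1 - h t) * (t * (1 - h t)) ≤ 1 * (t * 1) := by
        gcongr <;> linarith
      nlinarith
    · have : h t = 1 := by
        rw [hh]; simp only; rw [min_eq_left (by linarith), max_eq_right zero_le_one]
      rw [this]; simp; positivity
  · rw [key h hc, hysa, ← cfc_mul h h b, ← cfc_smul (D ^ 2) (fun t => h t * h t) b]
    refine cfc_mono fun t ht => ?_
    have h0 : 0 ≤ h t := le_max_left _ _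
    by_cases hlt : t ≤ D ^ 2
    · have : h t = 0 := by
        rw [hh]; simp only; rw [max_eq_left]; exact (min_le_right _ _).trans (by linarith)
      simp [this]
    · rw [smul_eq_mul]
      nlinarith [mul_nonneg h0 h0]

variable (f : A →ₚ[ℂ] ℂ)

/-- The canonical vector of `a` in the GNS space of `f`. -/
def gnsVec (a : A) : f.GNS := ((f.toPreGNS a : f.PreGNS) : Completion f.PreGNS)

theorem gnsVec_sub (a b : A) : gnsVec f (a - b) = gnsVec f a - gnsVec f b := by
  simp [gnsVec, Completion.coe_sub]

theorem inner_gnsVec (a b : A) : ⟪gnsVec f a, gnsVec f b⟫_ℂ = f (star a * b) := by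
  simp [gnsVec, PositiveLinearMap.preGNS_inner_def]

theorem norm_gnsVec_sq (a : A) : ((‖gnsVec f a‖ ^ 2 : ℝ) : ℂ) = f (star a * a) := by
  rw [← inner_gnsVec, inner_self_eq_norm_sq_to_K]; simp

theorem gnsStarAlgHom_gnsVec (a b : A) :
    f.gnsStarAlgHom a (gnsVec f b) = gnsVec f (a * b) := by
  simp [gnsVec, PositiveLinearMap.gnsStarAlgHom]

theorem norm_gnsVec_mul_le (a b : A) : ‖gnsVec f (a * b)‖ ≤ ‖a‖ * ‖gnsVec f b‖ := by
  rw [← gnsStarAlgHom_gnsVec]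
  exact ((f.gnsStarAlgHom a).le_opNorm _).trans
    (mul_le_mul_of_nonneg_right (NonUnitalStarAlgHom.norm_apply_le _ _) (norm_nonneg _))

theorem denseRange_gnsVec : DenseRange (gnsVec f) :=
  (Completion.denseRange_coe (α := f.PreGNS)).comp f.toPreGNS.surjective.denseRange
    (Completion.continuous_coe f.PreGNS)

/-- A positive functional is tracial if it vanishes on commutators. -/
def IsTracial : Prop := ∀ a b : A, f (a * b) = f (b * a)

variable {f}

theorem IsTracial.norm_gnsVec_star (hf : IsTracial f) (a : A) :
    ‖gnsVec f (star a)‖ = ‖gnsVec f a‖ := by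
  have h : ‖gnsVec f (star a)‖ ^ 2 = ‖gnsVec f a‖ ^ 2 := by
    rw [← Complex.ofReal_inj, norm_gnsVec_sq, norm_gnsVec_sq, star_star, hf]
  exact (pow_left_inj₀ (norm_nonneg _) (norm_nonneg _) two_ne_zero).1 h

/-- The involution is isometric on GNS vectors because `f` is tracial, and it turns right
multiplication into left multiplication. -/
theorem IsTracial.norm_gnsVec_mul_le' (hf : IsTracial f) (a b : A) :
    ‖gnsVec f (a * b)‖ ≤ ‖b‖ * ‖gnsVec f a‖ := by
  rw [← hf.norm_gnsVec_star, star_mul, ← hf.norm_gnsVec_star a, ← norm_star b]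
  exact norm_gnsVec_mul_le f _ _

/-- Right multiplication on the GNS space of a tracial functional. -/
def gnsRight (hf : IsTracial f) (b : A) : f.GNS →L[ℂ] f.GNS :=
  ContinuousLinearMap.completion
    ((f.toPreGNS.toLinearMap ∘ₗ (LinearMap.mulRight ℂ b) ∘ₗ f.ofPreGNS.toLinearMap).mkContinuous
      ‖b‖ fun x => by
        have := hf.norm_gnsVec_mul_le' (f.ofPreGNS x) b
        simpa [gnsVec] using this)

theorem gnsRight_gnsVec (hf : IsTracial f) (a b : A) :
    gnsRight hf b (gnsVec f a) = gnsVec f (a * b) := by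
  simp [gnsRight, gnsVec]

theorem ext_of_gnsVec {S T : f.GNS →L[ℂ] f.GNS}
    (h : ∀ a, S (gnsVec f a) = T (gnsVec f a)) : S = T := by
  refine ContinuousLinearMap.ext fun x => ?_
  exact congrFun ((denseRange_gnsVec f).equalizer S.continuous T.continuous (funext h)) x

theorem norm_gnsRight_le (hf : IsTracial f) (b : A) (ξ : f.GNS) :
    ‖gnsRight hf b ξ‖ ≤ ‖b‖ * ‖ξ‖ := by
  refine (denseRange_gnsVec f).induction_on (p := fun ξ => ‖gnsRight hf b ξ‖ ≤ ‖b‖ * ‖ξ‖) ξ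
    (isClosed_le (by fun_prop) (by fun_prop)) fun a => ?_
  rw [gnsRight_gnsVec]
  exact hf.norm_gnsVec_mul_le' a b

theorem star_gnsRight (hf : IsTracial f) (b : A) :
    star (gnsRight hf b) = gnsRight hf (star b) := by
  refine ((ContinuousLinearMap.eq_adjoint_iff _ _).2 fun x y => ?_).symm
  refine (denseRange_gnsVec f).induction_on
    (p := fun x => ⟪gnsRight hf (star b) x, y⟫_ℂ = ⟪x, gnsRight hf b y⟫_ℂ) x
    (isClosed_eq (by fun_prop) (by fun_prop)) fun a => ?_
  refine (denseRange_gnsVec f).induction_on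
    (p := fun y => ⟪gnsRight hf (star b) (gnsVec f a), y⟫_ℂ = ⟪gnsVec f a, gnsRight hf b y⟫_ℂ) y
    (isClosed_eq (by fun_prop) (by fun_prop)) fun c => ?_
  rw [gnsRight_gnsVec, gnsRight_gnsVec, inner_gnsVec, inner_gnsVec, star_mul, star_star, mul_assoc,
    hf, mul_assoc]

/-- The von Neumann algebra of operators commuting with right multiplications. -/
def leftVN (hf : IsTracial f) : VonNeumannAlgebra f.GNS where
  toStarSubalgebra := StarSubalgebra.centralizer ℂ (Set.range (gnsRight hf))
  centralizer_centralizer' := by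
    -- The third commutant of any set equals its first commutant.
    simp

/-- The *-centralizer also asks for commutation with adjoints; this is automatic, as right
multiplications are closed under adjoints. -/
theorem mem_leftVN (hf : IsTracial f) (T : f.GNS →L[ℂ] f.GNS) :
    T ∈ (leftVN hf).toStarSubalgebra ↔ ∀ b, gnsRight hf b * T = T * gnsRight hf b := by
  change T ∈ StarSubalgebra.centralizer ℂ (Set.range (gnsRight hf)) ↔ _
  rw [StarSubalgebra.mem_centralizer_iff]
  constructor
  · intro h b
    exact (h _ ⟨b, rfl⟩).1
  · rintro h _ ⟨b, rfl⟩
    refine ⟨h b, ?_⟩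
    rw [star_gnsRight]
    exact h _

theorem gnsStarAlgHom_mem_leftVN (hf : IsTracial f) (a : A) :
    f.gnsStarAlgHom a ∈ (leftVN hf).toStarSubalgebra := by
  rw [mem_leftVN]
  intro b
  refine ext_of_gnsVec fun c => ?_
  simp only [mul_apply_eq_comp, gnsStarAlgHom_gnsVec, gnsRight_gnsVec, mul_assoc]

/-- The value at the unit vector of an operator in the commutant of the right multiplications is
a limit of vectors coming from a bounded set. -/
theorem exists_bounded_approx (hf : IsTracial f) {T : f.GNS →L[ℂ] f.GNS}
    (hT : T ∈ (leftVN hf).toStarSubalgebra) {ε : ℝ} (hε : 0 < ε) :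
    ∃ z : A, ‖z‖ ≤ ‖T‖ + 2 ∧ ‖T (gnsVec f 1) - gnsVec f z‖ ≤ ε := by
  rw [mem_leftVN] at hT
  set ξ := T (gnsVec f 1) with hξ
  have hTx : ∀ x, T (gnsVec f x) = gnsRight hf x ξ := fun x => by
    have := congrArg (fun S : f.GNS →L[ℂ] f.GNS => S (gnsVec f 1)) (hT x)
    simp only [mul_apply_eq_comp, gnsRight_gnsVec, one_mul] at this
    exact this.symm
  set C := ‖T‖
  have hC : 0 ≤ C := norm_nonneg _
  -- The final error is δ + (C + 1)δ = ε.
  set δ := ε / (C + 2) with hδ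
  have hδ0 : 0 < δ := by positivity
  obtain ⟨a, ha⟩ := (denseRange_gnsVec f).exists_dist_lt ξ hδ0
  rw [dist_eq_norm] at ha
  -- Cutting one unit above ‖T‖ makes the removed part small: (C + 1)‖y‖ ≤ ‖ay‖ ≤ C‖y‖ + δ in the
  -- GNS norm forces ‖y‖ ≤ δ. This plays the role of Kaplansky's density theorem.
  obtain ⟨y, hy1, hy2, hy3⟩ := exists_truncation a (D := C + 1) (by positivity)
  have h1 : (C + 1) * ‖gnsVec f y‖ ≤ ‖gnsVec f (a * y)‖ := by
    have h := OrderHomClass.mono f hy3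
    have e : f ((C + 1) ^ 2 • (star y * y)) = (((C + 1) ^ 2 : ℝ) : ℂ) * f (star y * y) := by
      rw [← Complex.coe_smul, map_smul, smul_eq_mul]
    rw [e, ← norm_gnsVec_sq, ← norm_gnsVec_sq, ← Complex.ofReal_mul, Complex.real_le_real,
      ← mul_pow] at h
    exact le_of_sq_le_sq h (norm_nonneg _)
  have h2 : ‖gnsVec f (a * y)‖ ≤ C * ‖gnsVec f y‖ + δ := by
    have e : gnsVec f (a * y) = T (gnsVec f y) - gnsRight hf y (ξ - gnsVec f a) := by
      rw [hTx, map_sub, gnsRight_gnsVec]; abel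
    rw [e]
    refine (norm_sub_le _ _).trans (add_le_add (T.le_opNorm _) ?_)
    refine (norm_gnsRight_le hf _ _).trans ?_
    calc ‖y‖ * ‖ξ - gnsVec f a‖ ≤ 1 * δ := by gcongr
      _ = δ := one_mul _
  have h3 : ‖gnsVec f y‖ ≤ δ := by nlinarith
  have h4 : ‖gnsVec f (a * y)‖ ≤ (C + 1) * δ := by nlinarith
  refine ⟨a * (1 - y), by linarith, ?_⟩
  have e : ξ - gnsVec f (a * (1 - y)) = (ξ - gnsVec f a) + gnsVec f (a * y) := by
    rw [mul_sub, mul_one, gnsVec_sub]; abel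
  rw [e]
  calc ‖(ξ - gnsVec f a) + gnsVec f (a * y)‖ ≤ δ + (C + 1) * δ :=
        (norm_add_le _ _).trans (add_le_add ha.le h4)
    _ = ε := by rw [hδ]; field_simp; ring

/-- If norm-bounded sets of GNS vectors are closed, then the left multiplications exhaust the
commutant of the right multiplications. -/
theorem exists_eq_gnsStarAlgHom (hf : IsTracial f)
    (hcl : ∀ (ξ : f.GNS) (C : ℝ) (z : ℕ → A), (∀ m, ‖z m‖ ≤ C) →
      (∀ m, ‖ξ - gnsVec f (z m)‖ ≤ 1 / ((m : ℝ) + 1)) → ∃ x, gnsVec f x = ξ)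
    {T : f.GNS →L[ℂ] f.GNS} (hT : T ∈ (leftVN hf).toStarSubalgebra) :
    ∃ x, f.gnsStarAlgHom x = T := by
  choose z hz1 hz2 using fun m : ℕ =>
    exists_bounded_approx hf hT (ε := 1 / ((m : ℝ) + 1)) (by positivity)
  obtain ⟨x, hx⟩ := hcl _ _ z hz1 hz2
  rw [mem_leftVN] at hT
  -- An operator commuting with right multiplications is determined by its value at the unit vector:
  -- T y = (T 1) y = x y.
  refine ⟨x, ext_of_gnsVec fun y => ?_⟩
  have := congrArg (fun S : f.GNS →L[ℂ] f.GNS => S (gnsVec f 1)) (hT y)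
  simp only [mul_apply_eq_comp, gnsRight_gnsVec, one_mul] at this
  rw [← this, ← hx, gnsRight_gnsVec, gnsStarAlgHom_gnsVec]

end TracialGNS

end TracialStab

end

/-! ### The tracial ultraproduct of matrix algebras as a von Neumann algebra. -/

noncomputable section
namespace TracialStab
open Filter Topology UniformSpace
open scoped ComplexOrder InnerProductSpace Matrix.Norms.L2Operator ENNReal

/-- The C*-algebra of bounded sequences of matrices, with the supremum norm. -/
def SeqAlg (k : ℕ → ℕ) : Type := lp (fun i => Mat (k i)) ∞

variable {k : ℕ → ℕ}

namespace SeqAlg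

/-- The terms of a bounded sequence. -/
def eval (x : SeqAlg k) (i : ℕ) : Mat (k i) := x.1 i

instance : CoeFun (SeqAlg k) fun _ => ∀ i, Mat (k i) := ⟨eval⟩

@[ext] theorem ext {x y : SeqAlg k} (h : ∀ i, x i = y i) : x = y :=
  Subtype.ext (funext h)

/-- The element of `SeqAlg k` given by a bounded sequence. -/
def mk (x : ∀ i, Mat (k i)) (h : ∃ C, ∀ i, ‖x i‖ ≤ C) : SeqAlg k :=
  ⟨x, memℓp_infty (by obtain ⟨C, hC⟩ := h; exact ⟨C, by rintro _ ⟨i, rfl⟩; exact hC i⟩)⟩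

@[simp] theorem mk_apply (x : ∀ i, Mat (k i)) (h) (i : ℕ) : mk x h i = x i := rfl

variable [∀ i, NeZero (k i)]

instance : NormedRing (SeqAlg k) := inferInstanceAs (NormedRing (lp (fun i => Mat (k i)) ∞))
instance : StarRing (SeqAlg k) := inferInstanceAs (StarRing (lp (fun i => Mat (k i)) ∞))
instance : NormedAlgebra ℂ (SeqAlg k) :=
  inferInstanceAs (NormedAlgebra ℂ (lp (fun i => Mat (k i)) ∞))
instance : StarModule ℂ (SeqAlg k) := inferInstanceAs (StarModule ℂ (lp (fun i => Mat (k i)) ∞))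
instance : CStarRing (SeqAlg k) := inferInstanceAs (CStarRing (lp (fun i => Mat (k i)) ∞))
instance : CompleteSpace (SeqAlg k) := inferInstanceAs (CompleteSpace (lp (fun i => Mat (k i)) ∞))
instance : CStarAlgebra (SeqAlg k) where

@[simp] theorem add_apply (x y : SeqAlg k) (i : ℕ) : (x + y) i = x i + y i := rfl
@[simp] theorem sub_apply (x y : SeqAlg k) (i : ℕ) : (x - y) i = x i - y i := rfl
@[simp] theorem mul_apply (x y : SeqAlg k) (i : ℕ) : (x * y) i = x i * y i := rfl
@[simp] theorem star_apply (x : SeqAlg k) (i : ℕ) : (star x) i = star (x i) := rfl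
@[simp] theorem smul_apply (c : ℂ) (x : SeqAlg k) (i : ℕ) : (c • x) i = c • x i := rfl
@[simp] theorem one_apply (i : ℕ) : (1 : SeqAlg k) i = 1 := rfl
@[simp] theorem zero_apply (i : ℕ) : (0 : SeqAlg k) i = 0 := rfl
@[simp] theorem algebraMap_apply (c : ℂ) (i : ℕ) :
  (algebraMap ℂ (SeqAlg k) c) i = algebraMap ℂ (Mat (k i)) c := rfl

theorem norm_apply_le (x : SeqAlg k) (i : ℕ) : ‖x i‖ ≤ ‖x‖ :=
  lp.norm_apply_le_norm (by simp) (E := fun i => Mat (k i)) x i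

theorem norm_le {x : SeqAlg k} {C : ℝ} (h : ∀ i, ‖x i‖ ≤ C) : ‖x‖ ≤ C :=
  lp.norm_le_of_forall_le' (E := fun i => Mat (k i)) C h

instance : PartialOrder (SeqAlg k) := CStarAlgebra.spectralOrder _
instance : StarOrderedRing (SeqAlg k) := CStarAlgebra.spectralOrderedRing _

end SeqAlg

theorem norm_entry_le {n : ℕ} (x : Mat n) (i j : Fin n) : ‖x i j‖ ≤ ‖x‖ := by
  have h := Matrix.l2_opNorm_mulVec x (EuclideanSpace.single j 1)
  rw [PiLp.norm_single, norm_one, mul_one] at h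
  refine le_trans ?_ h
  have := PiLp.norm_apply_le (p := 2)
    ((EuclideanSpace.equiv (Fin n) ℂ).symm (x.mulVec (EuclideanSpace.single j (1 : ℂ)))) i
  simpa using this

/-- The normalized trace. -/
def ntr {n : ℕ} (x : Mat n) : ℂ := Matrix.trace x / n

theorem norm_ntr_le {n : ℕ} (x : Mat n) : ‖ntr x‖ ≤ ‖x‖ := by
  rw [ntr, norm_div, Complex.norm_natCast]
  refine div_le_of_le_mul₀ (Nat.cast_nonneg _) (norm_nonneg _) ?_
  refine (norm_sum_le _ _).trans ?_
  refine (Finset.sum_le_sum fun i _ => norm_entry_le x i i).trans ?_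
  simp [mul_comm]

theorem ntr_mul_comm {n : ℕ} (x y : Mat n) : ntr (x * y) = ntr (y * x) := by
  rw [ntr, ntr, Matrix.trace_mul_comm]

theorem ntr_one {n : ℕ} [NeZero n] : ntr (1 : Mat n) = 1 := by
  rw [ntr, Matrix.trace_one, Fintype.card_fin, div_self]
  exact Nat.cast_ne_zero.2 (NeZero.ne n)

theorem ntr_star_mul_self {n : ℕ} (x : Mat n) : ntr (star x * x) = (hsSq x : ℂ) := by
  rw [hsSq_eq, ntr]
  push_cast
  congr 1
  simp only [Matrix.trace, Matrix.diag, Matrix.mul_apply, Matrix.star_apply]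
  refine Finset.sum_congr rfl fun j _ => Finset.sum_congr rfl fun i _ => ?_
  rw [← Complex.conj_mul']
  rfl

variable [∀ i, NeZero (k i)]

theorem exists_tendsto_of_bounded (α : Ultrafilter ℕ) {g : ℕ → ℂ} {C : ℝ} (h : ∀ i, ‖g i‖ ≤ C) :
    ∃ z, Tendsto g α (𝓝 z) := by
  obtain ⟨z, -, hz⟩ := (isCompact_closedBall (0 : ℂ) C).ultrafilter_le_nhds (α.map g)
    (by
      rw [le_principal_iff]
      exact Filter.mem_map.2 (Filter.univ_mem' fun i => by simpa using h i))
  exact ⟨z, hz⟩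

theorem exists_tendsto_ntr (α : Ultrafilter ℕ) (x : SeqAlg k) :
    ∃ z, Tendsto (fun i => ntr (x i)) α (𝓝 z) :=
  exists_tendsto_of_bounded α fun i => (norm_ntr_le _).trans (x.norm_apply_le i)

/-- The limit along `α` of the normalized traces, as a positive functional. -/
def limTr (k : ℕ → ℕ) [∀ i, NeZero (k i)] (α : Ultrafilter ℕ) : SeqAlg k →ₚ[ℂ] ℂ :=
  .mk₀
    { toFun := fun x => (exists_tendsto_ntr α x).choose
      map_add' := fun x y => by
        refine tendsto_nhds_unique (exists_tendsto_ntr α (x + y)).choose_spec ?_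
        refine ((exists_tendsto_ntr α x).choose_spec.add
          (exists_tendsto_ntr α y).choose_spec).congr fun i => ?_
        simp [ntr, add_div]
      map_smul' := fun c x => by
        refine tendsto_nhds_unique (exists_tendsto_ntr α (c • x)).choose_spec ?_
        refine ((exists_tendsto_ntr α x).choose_spec.const_mul c).congr fun i => ?_
        simp [ntr, mul_div_assoc] }
    (fun x hx => by
      obtain ⟨y, rfl⟩ := CStarAlgebra.nonneg_iff_eq_star_mul_self.1 hx
      refine ge_of_tendsto' (exists_tendsto_ntr α (star y * y)).choose_spec fun i => ?_
      simp only [SeqAlg.mul_apply, SeqAlg.star_apply, ntr_star_mul_self]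
      exact Complex.zero_le_real.2 (hsSq_nonneg _))

theorem tendsto_limTr (α : Ultrafilter ℕ) (x : SeqAlg k) :
    Tendsto (fun i => ntr (x i)) α (𝓝 (limTr k α x)) :=
  (exists_tendsto_ntr α x).choose_spec

attribute [irreducible] limTr

theorem limTr_isTracial (α : Ultrafilter ℕ) : IsTracial (limTr k α) := fun a b => by
  refine tendsto_nhds_unique (tendsto_limTr α (a * b)) ((tendsto_limTr α (b * a)).congr fun i => ?_)
  simp [ntr_mul_comm]

theorem limTr_one (α : Ultrafilter ℕ) : limTr k α 1 = 1 := by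
  refine tendsto_nhds_unique (tendsto_limTr α 1) ?_
  simp [ntr_one]

theorem limTr_eq_zero_of_tendsto {α : Ultrafilter ℕ} {x : SeqAlg k}
    (h : Tendsto (fun i => ‖x i‖) α (𝓝 0)) : limTr k α x = 0 :=
  tendsto_nhds_unique (tendsto_limTr α x)
    (squeeze_zero_norm (fun _ => norm_ntr_le _) h)

/-- Translates between estimates in the GNS space and estimates that hold in α-almost every matrix
algebra. -/
theorem tendsto_hsSq (α : Ultrafilter ℕ) (x : SeqAlg k) :
    Tendsto (fun i => hsSq (x i)) α (𝓝 (‖gnsVec (limTr k α) x‖ ^ 2)) := by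
  have h := tendsto_limTr α (star x * x)
  rw [← norm_gnsVec_sq] at h
  simp only [SeqAlg.mul_apply, SeqAlg.star_apply, ntr_star_mul_self] at h
  exact (Complex.continuous_re.tendsto _).comp h

/-- Norm-bounded sets are closed in the GNS space of the limit trace. -/
theorem exists_gnsVec_eq_of_approx {α : Ultrafilter ℕ} (hα : (α : Filter ℕ) ≤ cofinite)
    (ξ : (limTr k α).GNS) (C : ℝ) (z : ℕ → SeqAlg k) (hz : ∀ m, ‖z m‖ ≤ C)
    (hξ : ∀ m, ‖ξ - gnsVec (limTr k α) (z m)‖ ≤ 1 / ((m : ℝ) + 1)) :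
    ∃ x, gnsVec (limTr k α) x = ξ := by
  classical
  -- At place i the m-th term is still close to all earlier ones. The GNS distances only give the
  -- constant 4 = 2²; the slack up to 5 makes the inequality hold α-eventually.
  set P : ℕ → ℕ → Prop := fun i m => ∀ l ≤ m, hsSq (z l i - z m i) ≤ 5 / ((l : ℝ) + 1) ^ 2 with hP
  have hev : ∀ m, ∀ᶠ i in (α : Filter ℕ), P i m := by
    intro m
    have : ∀ l ∈ Finset.range (m + 1),
        ∀ᶠ i in (α : Filter ℕ), hsSq (z l i - z m i) ≤ 5 / ((l : ℝ) + 1) ^ 2 := by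
      intro l hl
      have hlm : (l : ℝ) ≤ m := by
        exact_mod_cast Nat.lt_succ_iff.1 (Finset.mem_range.1 hl)
      have ht := tendsto_hsSq α (z l - z m)
      have hb : ‖gnsVec (limTr k α) (z l - z m)‖ ≤ 2 / ((l : ℝ) + 1) := by
        have e : gnsVec (limTr k α) (z l - z m) =
            (ξ - gnsVec (limTr k α) (z m)) - (ξ - gnsVec (limTr k α) (z l)) := by
          rw [gnsVec_sub]; abel
        rw [e]
        refine (norm_sub_le _ _).trans ?_
        have h1 : 1 / ((m : ℝ) + 1) ≤ 1 / ((l : ℝ) + 1) := by gcongr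
        calc _ ≤ 1 / ((l : ℝ) + 1) + 1 / ((l : ℝ) + 1) :=
              add_le_add ((hξ m).trans h1) (hξ l)
          _ = _ := by ring
      have hlt : ‖gnsVec (limTr k α) (z l - z m)‖ ^ 2 < 5 / ((l : ℝ) + 1) ^ 2 := by
        calc _ ≤ (2 / ((l : ℝ) + 1)) ^ 2 := by gcongr
          _ = 4 / ((l : ℝ) + 1) ^ 2 := by rw [div_pow]; norm_num
          _ < _ := by gcongr; norm_num
      exact (ht.eventually_lt_const hlt).mono fun i hi => hi.le
    filter_upwards [(Finset.eventually_all (Finset.range (m + 1))).2 this] with i hi l hl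
    exact hi l (Finset.mem_range.2 (Nat.lt_succ_of_le hl))
  -- Freeness of α enters here.
  have hge : ∀ m : ℕ, ∀ᶠ i in (α : Filter ℕ), m ≤ i := fun m =>
    hα (Filter.eventually_cofinite.2 ((Set.finite_lt_nat m).subset fun i hi => not_le.1 hi))
  have hP0 : ∀ i, P i 0 := by
    intro i l hl
    obtain rfl := Nat.le_zero.1 hl
    simp [hsSq]
  -- Diagonal choice: at place i use the last index up to i that is still good. By `hP0` the index 0
  -- is always good, so P i (μ i) holds for every i, and m ≤ μ i for α-almost every i.
  let μ : ℕ → ℕ := fun i => Nat.findGreatest (P i) i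
  let x : SeqAlg k := SeqAlg.mk (fun i => z (μ i) i)
    ⟨C, fun i => ((z (μ i)).norm_apply_le i).trans (hz _)⟩
  have hx : ∀ m, ‖gnsVec (limTr k α) (z m - x)‖ ^ 2 ≤ 5 / ((m : ℝ) + 1) ^ 2 := by
    intro m
    refine le_of_tendsto (tendsto_hsSq α (z m - x)) ?_
    filter_upwards [hev m, hge m] with i hi hmi
    have h1 : P i (μ i) := Nat.findGreatest_spec (P := P i) (Nat.zero_le i) (hP0 i)
    exact h1 m (Nat.le_findGreatest hmi hi)
  refine ⟨x, ?_⟩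
  have hb : ∀ m : ℕ, ‖ξ - gnsVec (limTr k α) x‖ ≤ 4 * (1 / ((m : ℝ) + 1)) := by
    intro m
    -- 3 is a convenient bound for √5, and 1 + 3 gives the factor 4 in `hb`.
    have h2 : ‖gnsVec (limTr k α) (z m - x)‖ ≤ 3 / ((m : ℝ) + 1) := by
      refine le_of_sq_le_sq ((hx m).trans ?_) (by positivity)
      rw [div_pow]
      gcongr
      norm_num
    have e : ξ - gnsVec (limTr k α) x =
        (ξ - gnsVec (limTr k α) (z m)) + gnsVec (limTr k α) (z m - x) := by
      rw [gnsVec_sub]; abel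
    rw [e]
    calc _ ≤ 1 / ((m : ℝ) + 1) + 3 / ((m : ℝ) + 1) :=
          (norm_add_le _ _).trans (add_le_add (hξ m) h2)
      _ = _ := by ring
  have hlim : Tendsto (fun m : ℕ => 4 * (1 / ((m : ℝ) + 1))) atTop (𝓝 0) := by
    simpa using tendsto_one_div_add_atTop_nhds_zero_nat.const_mul (4 : ℝ)
  have h0 : ‖ξ - gnsVec (limTr k α) x‖ ≤ 0 := ge_of_tendsto' hlim hb
  exact (sub_eq_zero.1 (norm_le_zero_iff.1 h0)).symm

/-- The tracial ultraproduct as a von Neumann algebra. -/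
abbrev ultraVN (k : ℕ → ℕ) [∀ i, NeZero (k i)] (α : Ultrafilter ℕ) :
    VonNeumannAlgebra (limTr k α).GNS :=
  leftVN (limTr_isTracial α)

/-- The quotient map from bounded sequences of matrices onto their tracial ultraproduct. -/
def ultraMk (k : ℕ → ℕ) [∀ i, NeZero (k i)] (α : Ultrafilter ℕ) :
    SeqAlg k →⋆ₐ[ℂ] (ultraVN k α).toStarSubalgebra :=
  (limTr k α).gnsStarAlgHom.codRestrict _ fun a => gnsStarAlgHom_mem_leftVN (limTr_isTracial α) a

theorem ultraMk_surjective {α : Ultrafilter ℕ} (hα : (α : Filter ℕ) ≤ cofinite) :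
    Function.Surjective (ultraMk k α) := by
  rintro ⟨T, hT⟩
  obtain ⟨x, hx⟩ := exists_eq_gnsStarAlgHom (limTr_isTracial α)
    (exists_gnsVec_eq_of_approx hα) hT
  exact ⟨x, Subtype.ext hx⟩

/-- The vector functional of the unit vector. -/
theorem inner_ultraMk (α : Ultrafilter ℕ) (x : SeqAlg k) :
    ⟪gnsVec (limTr k α) (1 : SeqAlg k), (ultraMk k α x).1 (gnsVec (limTr k α) 1)⟫_ℂ =
      limTr k α x := by
  change ⟪_, (limTr k α).gnsStarAlgHom x _⟫_ℂ = _
  rw [gnsStarAlgHom_gnsVec, inner_gnsVec, star_one, one_mul, mul_one]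

/-- The trace is dominated by the operator norm, so xa has GNS norm 0 for every a. This lets the map
descend to the quotient by null sequences. -/
theorem ultraMk_eq_zero_of_tendsto {α : Ultrafilter ℕ} {x : SeqAlg k}
    (h : Tendsto (fun i => ‖x i‖) α (𝓝 0)) : ultraMk k α x = 0 := by
  refine Subtype.ext (ext_of_gnsVec fun a => ?_)
  change (limTr k α).gnsStarAlgHom x _ = 0
  rw [gnsStarAlgHom_gnsVec, ← norm_eq_zero, ← sq_eq_zero_iff (a := ‖_‖), ← Complex.ofReal_inj,
    norm_gnsVec_sq, Complex.ofReal_zero]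
  refine limTr_eq_zero_of_tendsto ?_
  refine squeeze_zero (fun i => norm_nonneg _) (g := fun i => ‖star (x * a)‖ * (‖x i‖ * ‖a‖))
    (fun i => ?_) (by simpa using (h.mul_const ‖a‖).const_mul ‖star (x * a)‖)
  refine (norm_mul_le _ _).trans (mul_le_mul ((star (x * a)).norm_apply_le i) ?_
    (norm_nonneg _) (norm_nonneg _))
  exact (norm_mul_le _ _).trans (mul_le_mul_of_nonneg_left (a.norm_apply_le i) (norm_nonneg _))

end TracialStab

end

noncomputable section
namespace TracialStab
open Filter Topology
open scoped ComplexOrder InnerProductSpace Matrix.Norms.L2Operator ENNReal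

/-! ### Bounded matrix sequences as block diagonal operators on a Hilbert sum. -/

section BlockDiagonal

variable (k : ℕ → ℕ)

/-- The Hilbert sum of the spaces on which the matrix algebras act. -/
abbrev HilbertSum : Type := lp (fun i => EuclideanSpace ℂ (Fin (k i))) 2

/-- The inclusion of a summand. -/
def incl (i : ℕ) : EuclideanSpace ℂ (Fin (k i)) →L[ℂ] HilbertSum k :=
  lp.singleContinuousLinearMap ℂ (fun i => EuclideanSpace ℂ (Fin (k i))) 2 i

/-- The projection onto a summand. -/
def coproj (i : ℕ) : HilbertSum k →L[ℂ] EuclideanSpace ℂ (Fin (k i)) :=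
  lp.evalCLM ℂ (fun i => EuclideanSpace ℂ (Fin (k i))) 2 i

theorem adjoint_incl (i : ℕ) : ContinuousLinearMap.adjoint (incl k i) = coproj k i := by
  refine ((ContinuousLinearMap.eq_adjoint_iff _ _).2 fun x y => ?_).symm
  exact (lp.inner_single_right (𝕜 := ℂ) i y x).symm

theorem adjoint_coproj (i : ℕ) : ContinuousLinearMap.adjoint (coproj k i) = incl k i := by
  rw [← adjoint_incl, ContinuousLinearMap.adjoint_adjoint]

theorem coproj_incl_self (i : ℕ) (x : EuclideanSpace ℂ (Fin (k i))) :
    coproj k i (incl k i x) = x :=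
  lp.single_apply_self (E := fun i => EuclideanSpace ℂ (Fin (k i))) 2 i x

theorem coproj_incl_of_ne {i j : ℕ} (h : j ≠ i) (x : EuclideanSpace ℂ (Fin (k i))) :
    coproj k j (incl k i x) = 0 :=
  lp.single_apply_ne (E := fun i => EuclideanSpace ℂ (Fin (k i))) 2 i x h

theorem hilbertSum_ext {x y : HilbertSum k} (h : ∀ i, coproj k i x = coproj k i y) : x = y :=
  lp.ext (funext h)

theorem norm_incl (i : ℕ) (x : EuclideanSpace ℂ (Fin (k i))) : ‖incl k i x‖ = ‖x‖ :=
  lp.norm_single (E := fun i => EuclideanSpace ℂ (Fin (k i))) (p := 2) two_pos i x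

theorem norm_coproj_le (i : ℕ) (x : HilbertSum k) : ‖coproj k i x‖ ≤ ‖x‖ :=
  lp.norm_apply_le_norm (E := fun i => EuclideanSpace ℂ (Fin (k i))) (p := 2) two_ne_zero x i

theorem coproj_comp_incl (i : ℕ) : coproj k i ∘L incl k i = .id ℂ _ := by
  ext x : 1
  exact coproj_incl_self k i x

theorem toEuclideanCLM_injective {n : ℕ} :
    Function.Injective (Matrix.toEuclideanCLM (n := Fin n) (𝕜 := ℂ)) :=
  EquivLike.injective _

/-- The orthogonal projection onto a summand. -/
def blockProj (i : ℕ) : HilbertSum k →L[ℂ] HilbertSum k := incl k i ∘L coproj k i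

theorem star_blockProj (i : ℕ) : star (blockProj k i) = blockProj k i := by
  rw [ContinuousLinearMap.star_eq_adjoint, blockProj, ContinuousLinearMap.adjoint_comp,
    adjoint_incl, adjoint_coproj]

/-- The von Neumann algebra of block diagonal operators. -/
def blockVN : VonNeumannAlgebra (HilbertSum k) where
  toStarSubalgebra := StarSubalgebra.centralizer ℂ (Set.range (blockProj k))
  centralizer_centralizer' := by simp

theorem mem_blockVN {T : HilbertSum k →L[ℂ] HilbertSum k} :
    T ∈ (blockVN k).toStarSubalgebra ↔ ∀ i, blockProj k i * T = T * blockProj k i := by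
  change T ∈ StarSubalgebra.centralizer ℂ (Set.range (blockProj k)) ↔ _
  rw [StarSubalgebra.mem_centralizer_iff]
  constructor
  · intro h i
    exact (h _ ⟨i, rfl⟩).1
  · rintro h _ ⟨i, rfl⟩
    rw [star_blockProj]
    exact ⟨h i, h i⟩

/-- A diagonal block of an operator, as a matrix. -/
def block (T : HilbertSum k →L[ℂ] HilbertSum k) (i : ℕ) : Mat (k i) :=
  (Matrix.toEuclideanCLM (n := Fin (k i)) (𝕜 := ℂ)).symm (coproj k i ∘L T ∘L incl k i)

theorem toEuclideanCLM_block (T : HilbertSum k →L[ℂ] HilbertSum k) (i : ℕ) :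
    Matrix.toEuclideanCLM (n := Fin (k i)) (𝕜 := ℂ) (block k T i) = coproj k i ∘L T ∘L incl k i :=
  StarAlgEquiv.apply_symm_apply _ _

theorem norm_block_le (T : HilbertSum k →L[ℂ] HilbertSum k) (i : ℕ) : ‖block k T i‖ ≤ ‖T‖ := by
  rw [Matrix.cstar_norm_def, toEuclideanCLM_block]
  refine ContinuousLinearMap.opNorm_le_bound _ (norm_nonneg _) fun x => ?_
  calc ‖coproj k i (T (incl k i x))‖ ≤ ‖T (incl k i x)‖ := norm_coproj_le k i _
    _ ≤ ‖T‖ * ‖incl k i x‖ := T.le_opNorm _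
    _ = ‖T‖ * ‖x‖ := by rw [norm_incl]

theorem block_mul {S T : HilbertSum k →L[ℂ] HilbertSum k}
    (hT : T ∈ (blockVN k).toStarSubalgebra) (i : ℕ) :
    block k (S * T) i = block k S i * block k T i := by
  apply toEuclideanCLM_injective
  rw [map_mul, toEuclideanCLM_block, toEuclideanCLM_block, toEuclideanCLM_block]
  have h := (mem_blockVN k).1 hT i
  -- T leaves the i-th summand invariant, so its projection may be inserted between S and T; nothing
  -- is needed of S.
  have h2 : T ∘L incl k i = blockProj k i ∘L T ∘L incl k i := by
    calc T ∘L incl k i = (T ∘L incl k i) ∘L (coproj k i ∘L incl k i) := by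
          rw [coproj_comp_incl, ContinuousLinearMap.comp_id]
      _ = (T * blockProj k i) ∘L incl k i := rfl
      _ = (blockProj k i * T) ∘L incl k i := by rw [h]
  calc coproj k i ∘L S ∘L (T ∘L incl k i)
      = coproj k i ∘L S ∘L (blockProj k i ∘L T ∘L incl k i) := by rw [← h2]
    _ = _ := rfl

theorem block_star (T : HilbertSum k →L[ℂ] HilbertSum k) (i : ℕ) :
    block k (star T) i = star (block k T i) := by
  apply toEuclideanCLM_injective
  rw [map_star, toEuclideanCLM_block, toEuclideanCLM_block, ContinuousLinearMap.star_eq_adjoint,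
    ContinuousLinearMap.star_eq_adjoint, ContinuousLinearMap.adjoint_comp,
    ContinuousLinearMap.adjoint_comp, adjoint_incl, adjoint_coproj]
  rfl

variable [∀ i, NeZero (k i)]

/-- The sequence of diagonal blocks of a block diagonal operator. -/
def blocks : (blockVN k).toStarSubalgebra →⋆ₐ[ℂ] SeqAlg k where
  toFun T := SeqAlg.mk (block k T.1) ⟨‖T.1‖, norm_block_le k T.1⟩
  map_one' := by
    ext i : 1
    apply toEuclideanCLM_injective
    simp only [SeqAlg.mk_apply, toEuclideanCLM_block, SeqAlg.one_apply, map_one]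
    exact coproj_comp_incl k i
  map_mul' S T := by
    ext i : 1
    exact block_mul k T.2 i
  map_zero' := by
    ext i : 1
    apply toEuclideanCLM_injective
    simp [toEuclideanCLM_block]
  map_add' S T := by
    ext i : 1
    apply toEuclideanCLM_injective
    simp [toEuclideanCLM_block]
  commutes' c := by
    ext i : 1
    apply toEuclideanCLM_injective
    simp only [SeqAlg.mk_apply, toEuclideanCLM_block, SeqAlg.algebraMap_apply, AlgHomClass.commutes]
    ext x : 1
    change coproj k i (c • incl k i x) = c • x
    rw [map_smul, coproj_incl_self]
  map_star' T := by
    ext i : 1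
    exact block_star k T.1 i

/-- A bounded sequence acts diagonally on the Hilbert sum. Composed with `ultraMk`, this exhibits
the ultraproduct as a quotient of a von Neumann algebra. -/
theorem blocks_surjective : Function.Surjective (blocks k) := by
  intro x
  let T : HilbertSum k →L[ℂ] HilbertSum k :=
    lp.mapCLM 2 (fun i => Matrix.toEuclideanCLM (n := Fin (k i)) (𝕜 := ℂ) (x i)) (norm_nonneg x)
      fun i => by rw [← Matrix.cstar_norm_def]; exact x.norm_apply_le i
  have hT : ∀ (ξ : HilbertSum k) i, coproj k i (T ξ) =
      Matrix.toEuclideanCLM (n := Fin (k i)) (𝕜 := ℂ) (x i) (coproj k i ξ) := fun _ _ => rfl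
  refine ⟨⟨T, (mem_blockVN k).2 fun i => ?_⟩, ?_⟩
  · ext ξ : 1
    refine hilbertSum_ext k fun j => ?_
    change coproj k j (incl k i (coproj k i (T ξ))) = coproj k j (T (incl k i (coproj k i ξ)))
    rw [hT, hT]
    by_cases hij : j = i
    · subst hij
      rw [coproj_incl_self, coproj_incl_self]
    · rw [coproj_incl_of_ne k hij, coproj_incl_of_ne k hij, map_zero]
  · ext i : 1
    apply toEuclideanCLM_injective
    refine (toEuclideanCLM_block k T i).trans ?_
    ext ξ : 1
    change coproj k i (T (incl k i ξ)) = _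
    rw [hT, coproj_incl_self]

end BlockDiagonal

end TracialStab

end

noncomputable section
namespace TracialStab
open Filter Topology
open scoped ComplexOrder InnerProductSpace Matrix.Norms.L2Operator ENNReal

/-! ### Two isometries on ℓ² satisfying the Cuntz relations. -/

section Cuntz

/-- A separable infinite-dimensional Hilbert space. -/
abbrev EllTwo : Type := lp (fun _ : ℕ => ℂ) 2

/-- The standard basis vectors of `EllTwo`. -/
def basisVec (m : ℕ) : EllTwo := lp.single (E := fun _ : ℕ => ℂ) 2 m 1

theorem inner_basisVec (m : ℕ) (ξ : EllTwo) : ⟪basisVec m, ξ⟫_ℂ = ξ m := by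
  have := lp.inner_single_left (𝕜 := ℂ) (G := fun _ : ℕ => ℂ) m 1 ξ
  refine this.trans ?_
  simp

theorem basisVec_apply (m n : ℕ) : (basisVec m) n = if n = m then 1 else 0 := by
  rw [basisVec, lp.single_apply]
  simp [Pi.single_apply]

theorem inner_basisVec_basisVec (m n : ℕ) :
    ⟪basisVec m, basisVec n⟫_ℂ = if m = n then 1 else 0 := by
  rw [inner_basisVec, basisVec_apply]

theorem orthonormal_basisVec {g : ℕ → ℕ} (hg : Function.Injective g) :
    Orthonormal ℂ fun m => basisVec (g m) := by
  rw [orthonormal_iff_ite]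
  intro i j
  rw [inner_basisVec_basisVec]
  simp [hg.eq_iff]

/-- The pair (m, r) encodes the number 2m + r. -/
theorem pairing_injective (r : Fin 2) :
    Function.Injective fun m => (Nat.divModEquiv 2).symm (m, r) := fun m n h => by
  simpa using h

/-- The isometries mapping the standard basis to its even and odd parts. -/
def shift (r : Fin 2) : EllTwo →ₗᵢ[ℂ] EllTwo :=
  (orthonormal_basisVec (pairing_injective r)).orthogonalFamily.linearIsometry

theorem shift_basisVec (r : Fin 2) (m : ℕ) :
    shift r (basisVec m) = basisVec ((Nat.divModEquiv 2).symm (m, r)) := by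
  refine (OrthogonalFamily.linearIsometry_apply_single _ _).trans ?_
  simp

/-- The isometries `shift r` as bounded operators. -/
def shiftCLM (r : Fin 2) : EllTwo →L[ℂ] EllTwo := (shift r).toContinuousLinearMap

theorem ext_of_basisVec {S T : EllTwo →L[ℂ] EllTwo} (h : ∀ m, S (basisVec m) = T (basisVec m)) :
    S = T := by
  refine lp.ext_continuousLinearMap (by simp) fun m => ?_
  refine ContinuousLinearMap.ext_ring ?_
  exact h m

theorem star_shiftCLM_basisVec (r s : Fin 2) (m : ℕ) :
    star (shiftCLM r) (basisVec ((Nat.divModEquiv 2).symm (m, s))) =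
      if r = s then basisVec m else 0 := by
  refine lp.ext (funext fun n => ?_)
  rw [← inner_basisVec, ContinuousLinearMap.star_eq_adjoint,
    ContinuousLinearMap.adjoint_inner_right]
  change ⟪shift r (basisVec n), _⟫_ℂ = _
  rw [shift_basisVec, inner_basisVec_basisVec]
  by_cases hrs : r = s
  · subst hrs
    rw [if_pos rfl, basisVec_apply]
    simp
  · rw [if_neg hrs, if_neg]
    · rfl
    · intro h
      exact hrs (by simpa using congrArg Prod.snd ((Nat.divModEquiv 2).symm.injective h))

theorem star_shiftCLM_mul (r s : Fin 2) :
    star (shiftCLM r) * shiftCLM s = if r = s then 1 else 0 := by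
  refine ext_of_basisVec fun m => ?_
  change star (shiftCLM r) (shift s (basisVec m)) = _
  rw [shift_basisVec, star_shiftCLM_basisVec]
  split_ifs <;> rfl

theorem sum_shiftCLM_mul_star : ∑ r, shiftCLM r * star (shiftCLM r) = 1 := by
  refine ext_of_basisVec fun m => ?_
  obtain ⟨⟨l, s⟩, rfl⟩ := (Nat.divModEquiv 2).symm.surjective m
  rw [sum_apply]
  have : ∀ r, (shiftCLM r * star (shiftCLM r)) (basisVec ((Nat.divModEquiv 2).symm (l, s))) =
      if r = s then basisVec ((Nat.divModEquiv 2).symm (l, s)) else 0 := by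
    intro r
    change shiftCLM r (star (shiftCLM r) _) = _
    rw [star_shiftCLM_basisVec]
    split_ifs with h
    · subst h
      exact shift_basisVec r l
    · exact map_zero _
  rw [Finset.sum_congr rfl fun r _ => this r]
  simp

end Cuntz

/-! ### Matrix units from Cuntz families, and the UHF algebra they generate. -/

section MatrixUnits

variable {E : Type*} [CStarAlgebra E]

/-- A finite family of isometries whose ranges are orthogonal and span everything. -/
structure IsCuntzFamily {ι : Type*} [Fintype ι] [DecidableEq ι] (V : ι → E) : Prop where
  orthogonal : ∀ p q, star (V p) * V q = if p = q then 1 else 0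
  complete : ∑ p, V p * star (V p) = 1

variable {ι : Type*} [Fintype ι] [DecidableEq ι] {V : ι → E}

theorem IsCuntzFamily.mul_star_mul (hV : IsCuntzFamily V) (p q r s : ι) :
    V p * star (V q) * (V r * star (V s)) = if q = r then V p * star (V s) else 0 := by
  rw [mul_assoc, ← mul_assoc (star (V q)), hV.orthogonal]
  split_ifs <;> simp

/-- The representation of a matrix algebra given by a Cuntz family. -/
def IsCuntzFamily.rep (hV : IsCuntzFamily V) : Matrix ι ι ℂ →⋆ₐ[ℂ] E where
  toFun a := ∑ p, ∑ q, a p q • (V p * star (V q))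
  map_one' := by
    simp [Matrix.one_apply, ite_smul, hV.complete]
  map_mul' a b := by
    simp only [Finset.sum_mul, Finset.mul_sum, smul_mul_smul_comm, hV.mul_star_mul, smul_ite,
      smul_zero, Finset.sum_ite_eq', Finset.mem_univ, if_true,
      Matrix.mul_apply, Finset.sum_smul]
    symm
    rw [Finset.sum_congr rfl fun m _ => Finset.sum_comm, Finset.sum_comm]
    exact Finset.sum_congr rfl fun p _ => Finset.sum_comm
  map_zero' := by simp
  map_add' a b := by simp [add_smul, Finset.sum_add_distrib]
  commutes' c := by
    simp only [Matrix.algebraMap_matrix_apply, ite_smul, zero_smul, Finset.sum_ite_eq,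
      Finset.mem_univ, if_true, ← Finset.smul_sum, hV.complete, Algebra.algebraMap_eq_smul_one]
    simp
  map_star' a := by
    rw [Finset.sum_comm]
    simp [star_sum, star_smul, Matrix.star_apply]

theorem IsCuntzFamily.rep_apply (hV : IsCuntzFamily V) (a : Matrix ι ι ℂ) :
    hV.rep a = ∑ p, ∑ q, a p q • (V p * star (V q)) := rfl

theorem IsCuntzFamily.rep_injective [Nontrivial E] (hV : IsCuntzFamily V) :
    Function.Injective hV.rep := by
  rw [injective_iff_map_eq_zero]
  intro a ha
  ext r s
  -- Compressing between two of the isometries recovers a single matrix entry.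
  have h : star (V r) * hV.rep a * V s = a r s • (1 : E) := by
    rw [hV.rep_apply, Finset.mul_sum, Finset.sum_mul, Finset.sum_eq_single r]
    · rw [Finset.mul_sum, Finset.sum_mul, Finset.sum_eq_single s]
      · rw [mul_smul_comm, smul_mul_assoc, ← mul_assoc, hV.orthogonal, if_pos rfl, one_mul,
          hV.orthogonal, if_pos rfl]
      · intro q _ hq
        rw [mul_smul_comm, smul_mul_assoc, mul_assoc, mul_assoc, hV.orthogonal, if_neg hq]
        simp
      · simp
    · intro p _ hp
      rw [Finset.mul_sum, Finset.sum_mul]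
      refine Finset.sum_eq_zero fun q _ => ?_
      rw [mul_smul_comm, smul_mul_assoc, ← mul_assoc, hV.orthogonal, if_neg hp.symm]
      simp
    · simp
  rw [ha, mul_zero, zero_mul] at h
  simpa using h.symm

/-- Products of members of two Cuntz families form a Cuntz family. -/
theorem IsCuntzFamily.mul {κ l : Type*} [Fintype κ] [DecidableEq κ] [Fintype l] [DecidableEq l]
    {S : κ → E} (hV : IsCuntzFamily V) (hS : IsCuntzFamily S) (e : l ≃ ι × κ) :
    IsCuntzFamily fun p => V (e p).1 * S (e p).2 where
  orthogonal p q := by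
    rw [star_mul, mul_assoc, ← mul_assoc (star (V _)), hV.orthogonal]
    by_cases h : (e p).1 = (e q).1
    · rw [if_pos h, one_mul, hS.orthogonal]
      congr 1
      rw [← e.injective.eq_iff, Prod.ext_iff]
      simp [h]
    · rw [if_neg h, zero_mul, mul_zero, if_neg]
      rintro rfl
      exact h rfl
  complete := by
    rw [e.sum_comp (fun x : ι × κ => V x.1 * S x.2 * star (V x.1 * S x.2)), Fintype.sum_prod_type]
    rw [← hV.complete]
    refine Finset.sum_congr rfl fun p _ => ?_
    simp only [star_mul]
    calc ∑ r, V p * S r * (star (S r) * star (V p))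
        = V p * (∑ r, S r * star (S r)) * star (V p) := by
          simp only [Finset.mul_sum, Finset.sum_mul, mul_assoc]
      _ = _ := by rw [hS.complete, mul_one]

/-- Inserting ∑ S_r S_r* = 1 gives V_p V_q* = ∑_r (V_p S_r)(V_q S_r)*; the witness is the matrix a ⊗
1. -/
theorem IsCuntzFamily.range_rep_le {κ l : Type*} [Fintype κ] [DecidableEq κ] [Fintype l]
    [DecidableEq l] {S : κ → E} (hV : IsCuntzFamily V) (hS : IsCuntzFamily S) (e : l ≃ ι × κ) :
    Set.range hV.rep ⊆ Set.range (hV.mul hS e).rep := by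
  rintro _ ⟨a, rfl⟩
  refine ⟨Matrix.of fun p q => if (e p).2 = (e q).2 then a (e p).1 (e q).1 else 0, ?_⟩
  rw [IsCuntzFamily.rep_apply, IsCuntzFamily.rep_apply]
  have h1 : ∀ p : l, ∑ q : l, (Matrix.of fun p q => if (e p).2 = (e q).2 then a (e p).1 (e q).1
      else 0) p q • (V (e p).1 * S (e p).2 * star (V (e q).1 * S (e q).2)) =
      ∑ y : ι × κ, (if (e p).2 = y.2 then a (e p).1 y.1 else 0) •
        (V (e p).1 * S (e p).2 * star (V y.1 * S y.2)) := fun p =>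
    e.sum_comp (fun y : ι × κ => (if (e p).2 = y.2 then a (e p).1 y.1 else 0) •
        (V (e p).1 * S (e p).2 * star (V y.1 * S y.2)))
  simp only [h1]
  rw [e.sum_comp (fun x : ι × κ => ∑ y : ι × κ, (if x.2 = y.2 then a x.1 y.1 else 0) •
        (V x.1 * S x.2 * star (V y.1 * S y.2)))]
  simp only [Fintype.sum_prod_type, ite_smul, zero_smul, Finset.sum_ite_eq, Finset.mem_univ,
    if_true]
  refine Finset.sum_congr rfl fun p _ => ?_
  rw [Finset.sum_comm]
  refine Finset.sum_congr rfl fun q _ => ?_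
  rw [← Finset.smul_sum]
  congr 1
  calc ∑ r, V p * S r * star (V q * S r) = V p * (∑ r, S r * star (S r)) * star (V q) := by
        simp only [Finset.mul_sum, Finset.sum_mul, mul_assoc, star_mul]
    _ = _ := by rw [hS.complete, mul_one]

variable {S : Fin 2 → E}

/-- The words of length `n` in a Cuntz family of two isometries. -/
def cuntzWord (S : Fin 2 → E) : ∀ n : ℕ, Fin (2 ^ n) → E
  | 0 => fun _ => 1
  | n + 1 => fun p =>
      let e := (finCongr (pow_succ 2 n)).trans finProdFinEquiv.symm
      cuntzWord S n (e p).1 * S (e p).2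

theorem isCuntzFamily_cuntzWord (hS : IsCuntzFamily S) :
    ∀ n, IsCuntzFamily (cuntzWord S n)
  | 0 => by
      have : Subsingleton (Fin (2 ^ 0)) := by rw [pow_zero]; infer_instance
      refine ⟨fun p q => ?_, ?_⟩
      · simp [cuntzWord, Subsingleton.elim p q]
      · simp [cuntzWord]
  | n + 1 => (isCuntzFamily_cuntzWord hS n).mul hS _

end MatrixUnits

/-- A Cuntz pair generates a copy of the UHF algebra of type `2^∞`. -/
theorem exists_uhf : ∃ (U : Type) (_ : CStarAlgebra U) (σ : ∀ n, Mat (2 ^ n) →⋆ₐ[ℂ] U),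
    (∀ n, Function.Injective (σ n)) ∧ (Monotone fun n => Set.range (σ n)) ∧
      Dense (⋃ n, Set.range (σ n)) := by
  have hS : IsCuntzFamily shiftCLM := ⟨star_shiftCLM_mul, sum_shiftCLM_mul_star⟩
  have : Nontrivial EllTwo := ⟨basisVec 0, 0, fun h => by
    have := congrArg (fun ξ : EllTwo => ξ 0) h
    simp [basisVec_apply] at this⟩
  let ρ : ∀ n, Mat (2 ^ n) →⋆ₐ[ℂ] (EllTwo →L[ℂ] EllTwo) := fun n =>
    (isCuntzFamily_cuntzWord hS n).rep
  have hmono : Monotone fun n => (ρ n).range := monotone_nat_of_le_succ fun n =>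
    (isCuntzFamily_cuntzWord hS n).range_rep_le hS
      ((finCongr (pow_succ 2 n)).trans finProdFinEquiv.symm)
  let U := (⨆ n, (ρ n).range).topologicalClosure
  have hcl : IsClosed (U : Set (EllTwo →L[ℂ] EllTwo)) :=
    StarSubalgebra.isClosed_topologicalClosure _
  have hle : ∀ n, (ρ n).range ≤ U := fun n =>
    (le_iSup (fun n => (ρ n).range) n).trans (StarSubalgebra.le_topologicalClosure _)
  let σ : ∀ n, Mat (2 ^ n) →⋆ₐ[ℂ] U := fun n => (ρ n).codRestrict U fun a => hle n ⟨a, rfl⟩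
  have hσ : ∀ n a, (σ n a : EllTwo →L[ℂ] EllTwo) = ρ n a := fun _ _ => rfl
  refine ⟨U, inferInstance, σ, ?_, ?_, ?_⟩
  · intro n a b h
    exact (isCuntzFamily_cuntzWord hS n).rep_injective (congrArg Subtype.val h)
  · rintro m n hmn _ ⟨a, rfl⟩
    obtain ⟨b, hb⟩ := hmono hmn ⟨a, rfl⟩
    exact ⟨b, Subtype.ext hb⟩
  · intro x
    have hx : (x : EllTwo →L[ℂ] EllTwo) ∈ closure (⋃ n, Set.range (ρ n)) := by
      have h := x.2
      have e : ((⨆ n, (ρ n).range : StarSubalgebra ℂ _) : Set (EllTwo →L[ℂ] EllTwo)) =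
          ⋃ n, Set.range (ρ n) := by
        rw [StarSubalgebra.coe_iSup_of_directed hmono.directed_le]
        rfl
      rw [← e]
      exact h
    rw [Topology.IsInducing.subtypeVal.closure_eq_preimage_closure_image]
    refine closure_mono ?_ hx
    rintro _ ⟨_, ⟨n, rfl⟩, a, rfl⟩
    exact ⟨σ n a, Set.mem_iUnion.2 ⟨n, a, rfl⟩, rfl⟩

end TracialStab

end

/-! ### Extensions by null sequences built from an approximating system. -/

noncomputable section
namespace TracialStab
open Filter Topology
open scoped ComplexOrder Matrix.Norms.L2Operator ENNReal

/-- Algebras `D i` with increasing dense images in `C` and with faithful representations on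
finite-dimensional spaces. -/
structure ApproxSystem (C : Type) [CStarAlgebra C] (D : ℕ → Type) [∀ i, CStarAlgebra (D i)]
    (k : ℕ → ℕ) where
  /-- the embeddings of the approximating algebras -/
  σ : ∀ i, D i →⋆ₐ[ℂ] C
  /-- the matrix representations of the approximating algebras -/
  δ : ∀ i, D i →⋆ₐ[ℂ] Mat (k i)
  σ_injective : ∀ i, Function.Injective (σ i)
  δ_injective : ∀ i, Function.Injective (δ i)
  monotone_range : Monotone fun i => Set.range (σ i)
  dense_iUnion : Dense (⋃ i, Set.range (σ i))

namespace ApproxSystem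

variable {C : Type} [CStarAlgebra C] {D : ℕ → Type} [∀ i, CStarAlgebra (D i)] {k : ℕ → ℕ}
  (X : ApproxSystem C D k)

theorem norm_σ (i : ℕ) (d : D i) : ‖X.σ i d‖ = ‖d‖ :=
  NonUnitalStarAlgHom.norm_map _ (X.σ_injective i) d

theorem norm_δ (i : ℕ) (d : D i) : ‖X.δ i d‖ = ‖d‖ :=
  NonUnitalStarAlgHom.norm_map _ (X.δ_injective i) d

/-- The distances from c to the increasing ranges tend to 0; choose d i optimal up to 1/(i + 1). -/
theorem exists_approx (c : C) :
    ∃ d : ∀ i, D i, Tendsto (fun i => X.σ i (d i)) atTop (𝓝 c) := by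
  have h : ∀ i : ℕ, ∃ d : D i,
      dist c (X.σ i d) < Metric.infDist c (Set.range (X.σ i)) + 1 / ((i : ℝ) + 1) := by
    intro i
    obtain ⟨_, ⟨d, rfl⟩, hd⟩ := (Metric.infDist_lt_iff (Set.range_nonempty (X.σ i))).1
      (lt_add_of_pos_right (Metric.infDist c (Set.range (X.σ i)))
        (by positivity : (0 : ℝ) < 1 / ((i : ℝ) + 1)))
    exact ⟨d, hd⟩
  choose d hd using h
  refine ⟨d, Metric.tendsto_atTop.2 fun ε hε => ?_⟩
  obtain ⟨y, hy, hcy⟩ := Metric.mem_closure_iff.1 (X.dense_iUnion c) (ε / 2) (by positivity)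
  obtain ⟨n, hn⟩ := Set.mem_iUnion.1 hy
  obtain ⟨m, hm⟩ := exists_nat_one_div_lt (half_pos hε)
  refine ⟨max n m, fun i hi => ?_⟩
  rw [dist_comm]
  have h1 : Metric.infDist c (Set.range (X.σ i)) ≤ dist c y :=
    Metric.infDist_le_dist_of_mem (X.monotone_range ((le_max_left _ _).trans hi) hn)
  have h2 : 1 / ((i : ℝ) + 1) ≤ 1 / ((m : ℝ) + 1) := by
    have : (m : ℝ) ≤ i := by exact_mod_cast (le_max_right _ _).trans hi
    gcongr
  linarith [hd i]

/-- Both representations are isometric, so closeness in `C` is closeness of matrices. The estimates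
for the extension rest on this. -/
theorem norm_δ_sub_δ (i : ℕ) (d d' : D i) :
    ‖X.δ i d - X.δ i d'‖ = ‖X.σ i d - X.σ i d'‖ := by
  rw [← map_sub, ← map_sub, norm_δ, norm_σ]

/-- The connecting maps of the approximating algebras. -/
def up (n i : ℕ) (d : D n) : D i :=
  -- The default 0 makes `tail n` vanish on the blocks before n, so that it is multiplicative but in
  -- general not unital.
  if h : n ≤ i then (X.monotone_range h ⟨d, rfl⟩).choose else 0

theorem σ_up {n i : ℕ} (h : n ≤ i) (d : D n) : X.σ i (X.up n i d) = X.σ n d := by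
  rw [up, dif_pos h]
  exact (X.monotone_range h ⟨d, rfl⟩).choose_spec

theorem up_of_lt {n i : ℕ} (h : i < n) (d : D n) : X.up n i d = 0 := by
  rw [up, dif_neg (not_le.2 h)]

theorem up_add (n i : ℕ) (d d' : D n) : X.up n i (d + d') = X.up n i d + X.up n i d' := by
  by_cases h : n ≤ i
  · apply X.σ_injective i
    simp [σ_up, h]
  · simp [up_of_lt, not_le.1 h]

theorem up_mul (n i : ℕ) (d d' : D n) : X.up n i (d * d') = X.up n i d * X.up n i d' := by
  by_cases h : n ≤ i
  · apply X.σ_injective i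
    simp [σ_up, h]
  · simp [up_of_lt, not_le.1 h]

theorem up_smul (n i : ℕ) (c : ℂ) (d : D n) : X.up n i (c • d) = c • X.up n i d := by
  by_cases h : n ≤ i
  · apply X.σ_injective i
    simp [σ_up, h]
  · simp [up_of_lt, not_le.1 h]

theorem up_star (n i : ℕ) (d : D n) : X.up n i (star d) = star (X.up n i d) := by
  by_cases h : n ≤ i
  · apply X.σ_injective i
    simp [σ_up, h, map_star]
  · simp [up_of_lt, not_le.1 h]

theorem up_up {n m i : ℕ} (hnm : n ≤ m) (hmi : m ≤ i) (d : D n) :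
    X.up m i (X.up n m d) = X.up n i d := by
  apply X.σ_injective i
  rw [σ_up _ hmi, σ_up _ hnm, σ_up _ (hnm.trans hmi)]

theorem norm_up_le (n i : ℕ) (d : D n) : ‖X.up n i d‖ ≤ ‖d‖ := by
  by_cases h : n ≤ i
  · rw [← X.norm_σ, σ_up _ h, norm_σ]
  · simp [up_of_lt, not_le.1 h]

variable [∀ i, NeZero (k i)]

/-- The extension of `C` by null sequences of matrices determined by an approximating system. -/
def ext : StarSubalgebra ℂ (SeqAlg k × C) where
  -- The limit in `C` is determined by the matrix sequence; carrying it along makes the quotient map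
  -- a coordinate projection.
  carrier := {z | ∃ d : ∀ i, D i, Tendsto (fun i => X.σ i (d i)) atTop (𝓝 z.2) ∧
    Tendsto (fun i => ‖z.1 i - X.δ i (d i)‖) atTop (𝓝 0)}
  mul_mem' := by
    rintro ⟨x, c⟩ ⟨y, c'⟩ ⟨d, hd1, hd2⟩ ⟨d', hd1', hd2'⟩
    refine ⟨fun i => d i * d' i, by simpa using hd1.mul hd1', ?_⟩
    have hlim : Tendsto (fun i => ‖x i - X.δ i (d i)‖ * (‖y‖ + ‖y i - X.δ i (d' i)‖) +
        ‖x‖ * ‖y i - X.δ i (d' i)‖) atTop (𝓝 0) := by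
      simpa using (hd2.mul (hd2'.const_add ‖y‖)).add (hd2'.const_mul ‖x‖)
    refine squeeze_zero (fun i => norm_nonneg _) (fun i => ?_) hlim
    have e : (x * y) i - X.δ i (d i * d' i) =
        (x i - X.δ i (d i)) * X.δ i (d' i) + x i * (y i - X.δ i (d' i)) := by
      rw [map_mul, SeqAlg.mul_apply]; noncomm_ring
    change ‖(x * y) i - X.δ i (d i * d' i)‖ ≤ _
    rw [e]
    refine (norm_add_le _ _).trans (add_le_add ?_ ?_)
    · refine (norm_mul_le _ _).trans (mul_le_mul_of_nonneg_left ?_ (norm_nonneg _))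
      calc ‖X.δ i (d' i)‖ = ‖y i - (y i - X.δ i (d' i))‖ := by rw [sub_sub_cancel]
        _ ≤ ‖y i‖ + ‖y i - X.δ i (d' i)‖ := norm_sub_le _ _
        _ ≤ _ := by gcongr; exact y.norm_apply_le i
    · exact (norm_mul_le _ _).trans (mul_le_mul_of_nonneg_right (x.norm_apply_le i)
        (norm_nonneg _))
  add_mem' := by
    rintro ⟨x, c⟩ ⟨y, c'⟩ ⟨d, hd1, hd2⟩ ⟨d', hd1', hd2'⟩
    refine ⟨fun i => d i + d' i, by simpa using hd1.add hd1', ?_⟩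
    refine squeeze_zero (fun i => norm_nonneg _) (fun i => ?_) (by simpa using hd2.add hd2')
    change ‖x i + y i - X.δ i (d i + d' i)‖ ≤ _
    rw [map_add, add_sub_add_comm]
    exact norm_add_le _ _
  algebraMap_mem' := by
    intro r
    refine ⟨fun i => algebraMap ℂ (D i) r, ?_, ?_⟩
    · simp only [AlgHomClass.commutes]
      exact tendsto_const_nhds
    · simp [AlgHomClass.commutes]
  star_mem' := by
    rintro ⟨x, c⟩ ⟨d, hd1, hd2⟩
    refine ⟨fun i => star (d i), by simpa [map_star] using hd1.star, ?_⟩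
    refine hd2.congr fun i => ?_
    change _ = ‖star (x i) - X.δ i (star (d i))‖
    rw [map_star, ← star_sub, norm_star]

/-- Membership does not depend on the choice of the approximating sequence. -/
theorem tendsto_of_mem_ext {z : SeqAlg k × C} (hz : z ∈ X.ext) {d : ∀ i, D i}
    (hd : Tendsto (fun i => X.σ i (d i)) atTop (𝓝 z.2)) :
    Tendsto (fun i => ‖z.1 i - X.δ i (d i)‖) atTop (𝓝 0) := by
  obtain ⟨d', hd1, hd2⟩ := hz
  have h : Tendsto (fun i => ‖X.σ i (d' i) - X.σ i (d i)‖) atTop (𝓝 0) := by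
    simpa using (hd1.sub hd).norm
  refine squeeze_zero (fun i => norm_nonneg _) (fun i => ?_) (by simpa using hd2.add h)
  rw [← norm_δ_sub_δ, ← sub_add_sub_cancel _ (X.δ i (d' i))]
  exact norm_add_le _ _

/-- Closedness is what makes the extension a C*-algebra. One approximating sequence of the limit's
second coordinate is fixed and compared with the sequence of a nearby member. -/
instance isClosed_ext : IsClosed (X.ext : Set (SeqAlg k × C)) := by
  refine isClosed_of_closure_subset fun z hz => ?_
  obtain ⟨d, hd⟩ := X.exists_approx z.2
  refine ⟨d, hd, ?_⟩
  rw [Metric.tendsto_atTop]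
  intro ε hε
  -- Five errors: z.1 to w.1, w.1 to its approximants, and three in comparing the two approximating
  -- sequences in `C`.
  obtain ⟨w, hw, hzw⟩ := Metric.mem_closure_iff.1 hz (ε / 5) (by positivity)
  rw [dist_eq_norm] at hzw
  obtain ⟨d', hd1, hd2⟩ := hw
  have hx : ‖z.1 - w.1‖ < ε / 5 := (norm_fst_le (z - w)).trans_lt hzw
  have hc : ‖z.2 - w.2‖ < ε / 5 := (norm_snd_le (z - w)).trans_lt hzw
  have e1 := (Metric.tendsto_atTop.1 hd1) (ε / 5) (by positivity)
  have e2 := (Metric.tendsto_atTop.1 hd2) (ε / 5) (by positivity)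
  have e3 := (Metric.tendsto_atTop.1 hd) (ε / 5) (by positivity)
  obtain ⟨n1, h1⟩ := e1
  obtain ⟨n2, h2⟩ := e2
  obtain ⟨n3, h3⟩ := e3
  refine ⟨max n1 (max n2 n3), fun i hi => ?_⟩
  have h1 := h1 i ((le_max_left _ _).trans hi)
  have h2 := h2 i ((le_max_left _ _).trans ((le_max_right _ _).trans hi))
  have h3 := h3 i ((le_max_right _ _).trans ((le_max_right _ _).trans hi))
  rw [dist_eq_norm] at h1 h3
  rw [dist_zero_right, norm_norm] at h2 ⊢
  have a1 : ‖z.1 i - w.1 i‖ < ε / 5 := ((z.1 - w.1).norm_apply_le i).trans_lt hx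
  have a2 : ‖X.δ i (d' i) - X.δ i (d i)‖ < ε / 5 + ε / 5 + ε / 5 := by
    rw [norm_δ_sub_δ]
    have : X.σ i (d' i) - X.σ i (d i) =
        (X.σ i (d' i) - w.2) - (z.2 - w.2) - (X.σ i (d i) - z.2) := by abel
    rw [this]
    exact (norm_sub_le _ _).trans_lt
      (add_lt_add ((norm_sub_le _ _).trans_lt (add_lt_add h1 hc)) h3)
  have : z.1 i - X.δ i (d i) =
      (z.1 i - w.1 i) + (w.1 i - X.δ i (d' i)) + (X.δ i (d' i) - X.δ i (d i)) := by abel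
  rw [this]
  calc _ ≤ ‖z.1 i - w.1 i‖ + ‖w.1 i - X.δ i (d' i)‖ + ‖X.δ i (d' i) - X.δ i (d i)‖ :=
        norm_add₃_le
    _ < ε := by linarith

/-- The extension as a C*-algebra. -/
abbrev Alg : Type := X.ext

/-- The quotient map of the extension. -/
def quot : X.Alg →⋆ₐ[ℂ] C := (StarAlgHom.snd ℂ (SeqAlg k) C).comp X.ext.subtype

/-- The matrix sequence of an element of the extension. -/
def seq : X.Alg →⋆ₐ[ℂ] SeqAlg k := (StarAlgHom.fst ℂ (SeqAlg k) C).comp X.ext.subtype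

theorem alg_ext {a b : X.Alg} (h1 : X.seq a = X.seq b) (h2 : X.quot a = X.quot b) : a = b :=
  Subtype.ext (Prod.ext h1 h2)

theorem quot_surjective : Function.Surjective X.quot := by
  intro c
  obtain ⟨d, hd⟩ := X.exists_approx c
  obtain ⟨B, hB⟩ := hd.norm.bddAbove_range
  refine ⟨⟨(SeqAlg.mk (fun i => X.δ i (d i)) ⟨B, fun i => ?_⟩, c), d, hd, ?_⟩, rfl⟩
  · rw [norm_δ, ← X.norm_σ]
    exact hB ⟨i, rfl⟩
  · simp

/-- The norms ‖x i‖ are asymptotic to ‖σ i (d i)‖, which tend to ‖c‖. -/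
theorem quot_eq_zero_iff (a : X.Alg) :
    X.quot a = 0 ↔ Tendsto (fun i => ‖X.seq a i‖) atTop (𝓝 0) := by
  obtain ⟨⟨x, c⟩, d, hd1, hd2⟩ := a
  change c = 0 ↔ Tendsto (fun i => ‖x i‖) atTop (𝓝 0)
  constructor
  · rintro rfl
    refine squeeze_zero (fun i => norm_nonneg _) (fun i => ?_)
      (by simpa using hd2.add hd1.norm)
    calc ‖x i‖ = ‖(x i - X.δ i (d i)) + X.δ i (d i)‖ := by rw [sub_add_cancel]
      _ ≤ ‖x i - X.δ i (d i)‖ + ‖X.δ i (d i)‖ := norm_add_le _ _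
      _ = _ := by rw [norm_δ, norm_σ]
  · intro h
    have h0 : Tendsto (fun i => X.σ i (d i)) atTop (𝓝 0) := by
      refine squeeze_zero_norm (a := fun i => ‖x i‖ + ‖x i - X.δ i (d i)‖) (fun i => ?_)
        (by simpa using h.add hd2)
      rw [norm_σ, ← X.norm_δ]
      calc ‖X.δ i (d i)‖ = ‖x i - (x i - X.δ i (d i))‖ := by rw [sub_sub_cancel]
        _ ≤ _ := norm_sub_le _ _
    exact tendsto_nhds_unique hd1 h0

theorem seq_injective : Function.Injective X.seq := by
  rw [injective_iff_map_eq_zero]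
  intro a ha
  refine X.alg_ext (by rw [ha, map_zero]) ?_
  rw [map_zero, quot_eq_zero_iff]
  simp [ha]

/-- Null sequences as elements of the extension. -/
theorem exists_of_tendsto {x : SeqAlg k} (hx : Tendsto (fun i => ‖x i‖) atTop (𝓝 0)) :
    ∃ a : X.Alg, X.seq a = x ∧ X.quot a = 0 :=
  ⟨⟨(x, 0), fun _ => 0, by simp, by simpa using hx⟩, rfl, rfl⟩

/-- The embedding of an approximating algebra into the extension, starting at place `n`. -/
def tail (n : ℕ) : D n →⋆ₙₐ[ℂ] X.Alg where
  toFun d := ⟨(SeqAlg.mk (fun i => X.δ i (X.up n i d))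
      ⟨‖d‖, fun i => by rw [norm_δ]; exact X.norm_up_le n i d⟩, X.σ n d),
    fun i => X.up n i d, tendsto_const_nhds.congr' (by
      filter_upwards [eventually_ge_atTop n] with i hi
      exact (X.σ_up hi d).symm), by simp⟩
  map_smul' c d := by
    refine X.alg_ext (SeqAlg.ext fun i => ?_) (map_smul (X.σ n) c d)
    exact (congrArg (X.δ i) (X.up_smul n i c d)).trans (map_smul _ _ _)
  map_zero' := by
    have h : ∀ i, X.up n i 0 = 0 := fun i => by simpa using X.up_smul n i 0 0
    refine X.alg_ext (SeqAlg.ext fun i => ?_) (map_zero (X.σ n))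
    exact (congrArg (X.δ i) (h i)).trans (map_zero _)
  map_add' d d' := by
    refine X.alg_ext (SeqAlg.ext fun i => ?_) (map_add (X.σ n) d d')
    exact (congrArg (X.δ i) (X.up_add n i d d')).trans (map_add _ _ _)
  map_mul' d d' := by
    refine X.alg_ext (SeqAlg.ext fun i => ?_) (map_mul (X.σ n) d d')
    exact (congrArg (X.δ i) (X.up_mul n i d d')).trans (map_mul _ _ _)
  map_star' d := by
    refine X.alg_ext (SeqAlg.ext fun i => ?_) (map_star (X.σ n) d)
    exact (congrArg (X.δ i) (X.up_star n i d)).trans (map_star _ _)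

theorem quot_tail (n : ℕ) (d : D n) : X.quot (X.tail n d) = X.σ n d := rfl

theorem seq_tail (n : ℕ) (d : D n) (i : ℕ) : X.seq (X.tail n d) i = X.δ i (X.up n i d) := rfl

/-- The elements of the extension that are determined by their first `n` terms and an element of
the `n`-th approximating algebra. -/
def stage (n : ℕ) : StarSubalgebra ℂ X.Alg where
  carrier := {a | ∃ d : D n, X.quot a = X.σ n d ∧ ∀ i, n ≤ i → X.seq a i = X.δ i (X.up n i d)}
  mul_mem' := by
    rintro a b ⟨d, h1, h2⟩ ⟨d', h1', h2'⟩
    refine ⟨d * d', by rw [map_mul, map_mul, h1, h1'], fun i hi => ?_⟩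
    rw [up_mul, map_mul, map_mul, SeqAlg.mul_apply, h2 i hi, h2' i hi]
  add_mem' := by
    rintro a b ⟨d, h1, h2⟩ ⟨d', h1', h2'⟩
    refine ⟨d + d', by rw [map_add, map_add, h1, h1'], fun i hi => ?_⟩
    rw [up_add, map_add, map_add, SeqAlg.add_apply, h2 i hi, h2' i hi]
  algebraMap_mem' := by
    intro r
    refine ⟨algebraMap ℂ _ r, by rw [AlgHomClass.commutes, AlgHomClass.commutes], fun i hi => ?_⟩
    have : X.up n i (algebraMap ℂ _ r) = algebraMap ℂ _ r := by
      apply X.σ_injective i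
      rw [σ_up _ hi, AlgHomClass.commutes, AlgHomClass.commutes]
    rw [this, AlgHomClass.commutes, AlgHomClass.commutes]
    rfl
  star_mem' := by
    rintro a ⟨d, h1, h2⟩
    refine ⟨star d, by rw [map_star, map_star, h1], fun i hi => ?_⟩
    rw [up_star, map_star, map_star, SeqAlg.star_apply, h2 i hi]

theorem stage_mono : Monotone X.stage := by
  rintro n m hnm a ⟨d, h1, h2⟩
  refine ⟨X.up n m d, by rw [h1, σ_up _ hnm], fun i hi => ?_⟩
  rw [h2 i (hnm.trans hi), up_up _ hnm hi]

/-- The first n blocks and the image in `C` determine an element, since injectivity of `σ n`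
recovers d and with it all later blocks. -/
theorem finiteDimensional_stage (n : ℕ) [FiniteDimensional ℂ (D n)] :
    FiniteDimensional ℂ (X.stage n) := by
  let R := LinearMap.range (X.σ n).toAlgHom.toLinearMap
  let L : X.stage n →ₗ[ℂ] (∀ i : Fin n, Mat (k i)) × R :=
    { toFun := fun a => (fun i => X.seq a.1 i, ⟨X.quot a.1, by
        obtain ⟨d, hd, -⟩ := a.2
        exact ⟨d, hd.symm⟩⟩)
      map_add' := fun a b => rfl
      map_smul' := fun c a => rfl }
  refine FiniteDimensional.of_injective L fun a b hab => ?_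
  obtain ⟨a, d, h1, h2⟩ := a
  obtain ⟨b, d', h1', h2'⟩ := b
  have q : X.quot a = X.quot b := congrArg (fun z => (z.2 : C)) hab
  have hdd : d = d' := X.σ_injective n (by rw [← h1, ← h1', q])
  subst hdd
  refine Subtype.ext (X.alg_ext (SeqAlg.ext fun i => ?_) q)
  by_cases hi : n ≤ i
  · exact (h2 i hi).trans (h2' i hi).symm
  · exact congrFun (congrArg Prod.fst hab) ⟨i, not_le.1 hi⟩

theorem dense_iUnion_stage : Dense (⋃ n, (X.stage n : Set X.Alg)) := by
  intro a
  rw [Metric.mem_closure_iff]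
  intro ε hε
  obtain ⟨d, hd⟩ := X.exists_approx (X.quot a)
  have hx := X.tendsto_of_mem_ext a.2 hd
  -- Beyond n the error has three parts of size ε/4, leaving room for strict inequality.
  obtain ⟨n1, h1⟩ := (Metric.tendsto_atTop.1 hd) (ε / 4) (by positivity)
  obtain ⟨n2, h2⟩ := (Metric.tendsto_atTop.1 hx) (ε / 4) (by positivity)
  set n := max n1 n2
  classical
  obtain ⟨y, hy1, hy2⟩ := X.exists_of_tendsto
    (x := SeqAlg.mk (fun i => if i < n then X.seq a i else 0) ⟨‖X.seq a‖, fun i => by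
      split_ifs
      · exact (X.seq a).norm_apply_le i
      · simp⟩)
    (tendsto_const_nhds.congr' (by
      filter_upwards [eventually_ge_atTop n] with i hi
      simp [not_lt.2 hi]))
  -- Keep the first n blocks of a exactly and replace all others by the images of the single element
  -- d n.
  refine ⟨y + X.tail n (d n), Set.mem_iUnion.2 ⟨n, d n, ?_, fun i hi => ?_⟩, ?_⟩
  · rw [map_add, hy2, zero_add, quot_tail]
  · rw [map_add, hy1, SeqAlg.add_apply, seq_tail, SeqAlg.mk_apply, if_neg (not_lt.2 hi), zero_add]
  have hn := h1 n (le_max_left _ _)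
  rw [dist_eq_norm] at hn
  rw [dist_eq_norm]
  have hs : ‖X.seq (a - (y + X.tail n (d n)))‖ ≤ ε / 4 + ε / 4 + ε / 4 := by
    refine SeqAlg.norm_le fun i => ?_
    rw [map_sub, map_add, hy1, SeqAlg.sub_apply, SeqAlg.add_apply, seq_tail, SeqAlg.mk_apply]
    by_cases hi : i < n
    · rw [if_pos hi, up_of_lt _ hi, map_zero, add_zero, sub_self, norm_zero]
      positivity
    · have hi := not_lt.1 hi
      rw [if_neg (not_lt.2 hi), zero_add]
      have g1 := h1 i ((le_max_left _ _).trans hi)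
      have g2 := h2 i ((le_max_right _ _).trans hi)
      rw [dist_eq_norm] at g1
      rw [dist_zero_right, norm_norm] at g2
      have g3 : ‖X.δ i (d i) - X.δ i (X.up n i (d n))‖ ≤ ε / 4 + ε / 4 := by
        rw [norm_δ_sub_δ, σ_up _ hi, ← sub_sub_sub_cancel_right _ _ (X.quot a)]
        exact (norm_sub_le _ _).trans (add_le_add g1.le hn.le)
      rw [← sub_add_sub_cancel _ (X.δ i (d i))]
      have g2' : ‖X.seq a i - X.δ i (d i)‖ ≤ ε / 4 := g2.le
      refine (norm_add_le _ _).trans ?_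
      linarith
  have hq : ‖X.quot (a - (y + X.tail n (d n)))‖ ≤ ε / 4 := by
    rw [map_sub, map_add, hy2, zero_add, quot_tail, norm_sub_rev]
    exact hn.le
  refine (max_le hs (hq.trans (by linarith)) : ‖a - (y + X.tail n (d n))‖ ≤ _).trans_lt ?_
  linarith

theorem isAF [∀ n, FiniteDimensional ℂ (D n)] : IsAF X.Alg :=
  ⟨X.stage, X.stage_mono, fun n => X.finiteDimensional_stage n, X.dense_iUnion_stage⟩

theorem isRFD : IsRFD X.Alg := by
  intro a ha
  have h : X.seq a ≠ 0 := fun h => ha (X.seq_injective (by rw [h, map_zero]))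
  obtain ⟨i, hi⟩ : ∃ i, X.seq a i ≠ 0 := by
    by_contra! hc
    exact h (SeqAlg.ext hc)
  let ev : SeqAlg k →⋆ₐ[ℂ] Mat (k i) :=
    { toFun := fun x => x i
      map_one' := rfl
      map_mul' := fun _ _ => rfl
      map_zero' := rfl
      map_add' := fun _ _ => rfl
      commutes' := fun _ => rfl
      map_star' := fun _ => rfl }
  exact ⟨k i, ev.comp X.seq, hi⟩

end ApproxSystem

end TracialStab

end

noncomputable section
namespace TracialStab
open Filter Topology
open scoped ComplexOrder InnerProductSpace Matrix.Norms.L2Operator ENNReal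

/-! ### Descent of homomorphisms to a quotient. -/

section Descent

/-- A *-homomorphism descends along a surjective one with smaller kernel. -/
theorem exists_descend {A C N : Type*} [Ring A] [Algebra ℂ A] [StarRing A] [Ring C] [Algebra ℂ C]
    [StarRing C] [Ring N] [Algebra ℂ N] [StarRing N] (π : A →⋆ₐ[ℂ] C)
    (hπ : Function.Surjective π) (f : A →⋆ₐ[ℂ] N) (h : ∀ a, π a = 0 → f a = 0) :
    ∃ F : C →⋆ₐ[ℂ] N, ∀ a, F (π a) = f a := by
  have key : ∀ a b, π a = π b → f a = f b := fun a b hab => by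
    rw [← sub_eq_zero, ← map_sub]
    exact h _ (by rw [map_sub, hab, sub_self])
  have hs : ∀ c, π (Function.surjInv hπ c) = c := Function.surjInv_eq hπ
  refine ⟨{ toFun := fun c => f (Function.surjInv hπ c)
            map_one' := ?_, map_mul' := fun c c' => ?_, map_zero' := ?_
            map_add' := fun c c' => ?_, commutes' := fun r => ?_, map_star' := fun c => ?_ }, ?_⟩
  · rw [key _ 1 (by rw [hs, map_one]), map_one]
  · rw [key _ (Function.surjInv hπ c * Function.surjInv hπ c') (by rw [hs, map_mul, hs, hs]),
      map_mul]
  · rw [key _ 0 (by rw [hs, map_zero]), map_zero]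
  · rw [key _ (Function.surjInv hπ c + Function.surjInv hπ c') (by rw [hs, map_add, hs, hs]),
      map_add]
  · rw [key _ (algebraMap ℂ A r) (by rw [hs, AlgHomClass.commutes]), AlgHomClass.commutes]
  · rw [key _ (star (Function.surjInv hπ c)) (by rw [hs, map_star, hs]), map_star]
  · intro a
    exact key _ _ (hs _)

end Descent

/-! ### Traces, small representations and block matrices. -/

section MatrixFacts

theorem hsSq_le_norm_sq {n : ℕ} (x : Mat n) : hsSq x ≤ ‖x‖ ^ 2 := by
  have h := norm_ntr_le (star x * x)
  rw [ntr_star_mul_self, CStarRing.norm_star_mul_self, Complex.norm_real, ← sq] at h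
  exact (le_abs_self _).trans h

/-- Cauchy–Schwarz for the diagonal entries. It makes normalized traces pass to the tracial
ultraproduct. -/
theorem norm_ntr_sq_le {n : ℕ} (x : Mat n) : ‖ntr x‖ ^ 2 ≤ hsSq x := by
  rcases Nat.eq_zero_or_pos n with rfl | hn
  · simp [ntr, hsSq]
  have hn' : (0 : ℝ) < n := Nat.cast_pos.2 hn
  rw [hsSq_eq, ntr, norm_div, Complex.norm_natCast, div_pow, div_le_div_iff₀ (by positivity) hn']
  have h1 : ‖Matrix.trace x‖ ^ 2 ≤ (∑ i, ‖x i i‖) ^ 2 := by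
    gcongr
    exact norm_sum_le _ _
  have h2 : (∑ i, ‖x i i‖) ^ 2 ≤ n * ∑ i, ‖x i i‖ ^ 2 := by
    simpa using sq_sum_le_card_mul_sum_sq (s := Finset.univ) (f := fun i => ‖x i i‖)
  have h3 : ∑ i, ‖x i i‖ ^ 2 ≤ ∑ j, ∑ i, ‖x i j‖ ^ 2 := Finset.sum_le_sum fun j _ =>
    Finset.single_le_sum (f := fun i => ‖x i j‖ ^ 2) (fun i _ => by positivity) (Finset.mem_univ j)
  have h4 := mul_le_mul_of_nonneg_left h3 hn'.le
  nlinarith [h1.trans (h2.trans h4)]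

/-- A matrix algebra has no nonzero homomorphisms into algebras of smaller dimension. -/
theorem map_eq_zero_of_finrank_lt {m : ℕ} {B : Type*} [Ring B] [Algebra ℂ B]
    [FiniteDimensional ℂ B] (h : Module.finrank ℂ B < m * m) (f : Mat m →ₙₐ[ℂ] B) (b : Mat m) :
    f b = 0 := by
  have hlt : Module.finrank ℂ B < Module.finrank ℂ (Mat m) := by
    rwa [Module.finrank_matrix, Fintype.card_fin, Module.finrank_self, mul_one]
  have hker := LinearMap.ker_ne_bot_of_finrank_lt (f := (f : Mat m →ₗ[ℂ] B)) hlt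
  obtain ⟨a, ha, ha0⟩ := (Submodule.ne_bot_iff _).1 hker
  have ha : f a = 0 := ha
  -- Simplicity of the matrix algebra by hand: a nonzero entry of a kernel element is moved by
  -- matrix units to every diagonal position, so the kernel contains 1.
  obtain ⟨p, q, hpq⟩ : ∃ p q, a p q ≠ 0 := by
    by_contra! hc
    exact ha0 (Matrix.ext hc)
  have hr : ∀ r, f (Matrix.single r r 1) = 0 := by
    intro r
    have e : Matrix.single r r (1 : ℂ) =
        (a p q)⁻¹ • (Matrix.single r p 1 * a * Matrix.single q r 1) := by
      rw [Matrix.single_mul_mul_single]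
      simp [hpq]
    rw [e, map_smul, map_mul, map_mul, ha, mul_zero, zero_mul, smul_zero]
  have h1 : f 1 = 0 := by
    have : (1 : Mat m) = ∑ r, Matrix.single r r 1 := by
      ext i j
      rw [Matrix.sum_apply, Finset.sum_eq_single i]
      · simp [Matrix.one_apply, Matrix.single_apply]
      · intro r _ hr
        simp [hr]
      · simp
    rw [this, map_sum]
    exact Finset.sum_eq_zero fun r _ => hr r
  rw [← one_mul b, map_mul, h1, zero_mul]

/-- Block diagonal embedding of two copies of a matrix algebra. -/
def blockDiag (m : ℕ) : Mat m × Mat m →⋆ₐ[ℂ] Mat (m + m) where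
  toFun a := Matrix.reindex finSumFinEquiv finSumFinEquiv (Matrix.fromBlocks a.1 0 0 a.2)
  map_one' := by simp
  map_mul' a b := by
    simp only [Matrix.reindex_apply, Matrix.submatrix_mul_equiv, Matrix.fromBlocks_multiply]
    simp
  map_zero' := by simp
  map_add' a b := by
    have h : Matrix.fromBlocks (a + b).1 0 0 (a + b).2 =
        Matrix.fromBlocks a.1 0 0 a.2 + Matrix.fromBlocks b.1 0 0 b.2 := by
      simp [Matrix.fromBlocks_add]
    rw [h]
    rfl
  commutes' r := by
    have h : Matrix.fromBlocks (r • (1 : Mat m)) 0 0 (r • (1 : Mat m)) = r • 1 := by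
      rw [← Matrix.fromBlocks_one, Matrix.fromBlocks_smul, smul_zero]
    simp [Algebra.algebraMap_eq_smul_one, h, Matrix.submatrix_smul]
  map_star' a := by
    simp [Matrix.star_eq_conjTranspose, Matrix.fromBlocks_conjTranspose]

theorem blockDiag_injective (m : ℕ) : Function.Injective (blockDiag m) := by
  intro a b h
  have h' := (Matrix.reindex finSumFinEquiv finSumFinEquiv).injective h
  rw [Matrix.fromBlocks_inj] at h'
  exact Prod.ext h'.1 h'.2.2.2

/-- The partial isometry between the two blocks. -/
def blockSwap (m : ℕ) : Mat (m + m) :=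
  Matrix.reindex finSumFinEquiv finSumFinEquiv (Matrix.fromBlocks 0 1 0 0)

/-- Within one full matrix block the two halves are equivalent projections, although the units of
the two summands of the block diagonal algebra are not. -/
theorem blockSwap_mul_star (m : ℕ) : blockSwap m * star (blockSwap m) = blockDiag m (1, 0) := by
  change _ = Matrix.reindex finSumFinEquiv finSumFinEquiv _
  simp [blockSwap, Matrix.star_eq_conjTranspose, Matrix.fromBlocks_conjTranspose,
    Matrix.fromBlocks_multiply]

theorem star_blockSwap_mul (m : ℕ) : star (blockSwap m) * blockSwap m = blockDiag m (0, 1) := by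
  change _ = Matrix.reindex finSumFinEquiv finSumFinEquiv _
  simp [blockSwap, Matrix.star_eq_conjTranspose, Matrix.fromBlocks_conjTranspose,
    Matrix.fromBlocks_multiply]

end MatrixFacts

/-! ### The approximating system for two copies of the UHF algebra. -/

/-- The sizes of the matrix blocks. -/
abbrev blockSize (i : ℕ) : ℕ := 2 ^ i + 2 ^ i

instance (i : ℕ) : NeZero (blockSize i) := ⟨by positivity⟩

/-- The approximating algebras of a double UHF algebra. -/
abbrev DoubleMat (i : ℕ) : Type := Mat (2 ^ i) × Mat (2 ^ i)

/-- The approximating system of two copies of the UHF algebra. -/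
def uhfSystem {U : Type} [CStarAlgebra U] (σ : ∀ n, Mat (2 ^ n) →⋆ₐ[ℂ] U)
    (hinj : ∀ n, Function.Injective (σ n)) (hmono : Monotone fun n => Set.range (σ n))
    (hdense : Dense (⋃ n, Set.range (σ n))) : ApproxSystem (U × U) DoubleMat blockSize where
  σ i := ((σ i).comp (StarAlgHom.fst ℂ _ _)).prod ((σ i).comp (StarAlgHom.snd ℂ _ _))
  δ i := blockDiag (2 ^ i)
  σ_injective i a b h := Prod.ext (hinj i (congrArg Prod.fst h)) (hinj i (congrArg Prod.snd h))
  δ_injective i := blockDiag_injective _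
  monotone_range := by
    rintro i j hij _ ⟨⟨a, b⟩, rfl⟩
    obtain ⟨a', ha⟩ := hmono hij ⟨a, rfl⟩
    obtain ⟨b', hb⟩ := hmono hij ⟨b, rfl⟩
    exact ⟨(a', b'), Prod.ext ha hb⟩
  dense_iUnion := by
    refine (hdense.prod hdense).mono ?_
    rintro ⟨x, y⟩ ⟨hx, hy⟩
    obtain ⟨n, hn⟩ := Set.mem_iUnion.1 hx
    obtain ⟨m, hm⟩ := Set.mem_iUnion.1 hy
    obtain ⟨a, ha⟩ := hmono (le_max_left n m) hn
    obtain ⟨b, hb⟩ := hmono (le_max_right n m) hm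
    exact Set.mem_iUnion.2 ⟨max n m, (a, b), Prod.ext ha hb⟩

/-- The inclusion of `SeqAlg k` into the bounded sequences. -/
def toBounded (k : ℕ → ℕ) [∀ i, NeZero (k i)] : SeqAlg k →⋆ₐ[ℂ] boundedSeq k where
  toFun x := ⟨x.eval, ‖x‖, x.norm_apply_le⟩
  map_one' := rfl
  map_mul' _ _ := rfl
  map_zero' := rfl
  map_add' _ _ := rfl
  commutes' _ := rfl
  map_star' _ := rfl

theorem toBounded_bijective (k : ℕ → ℕ) [∀ i, NeZero (k i)] :
    Function.Bijective (toBounded k) :=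
  ⟨fun _ _ h => SeqAlg.ext fun i => congrFun (congrArg Subtype.val h) i,
    fun x => ⟨SeqAlg.mk x.1 x.2, rfl⟩⟩

/-- The normalized traces of a representative of the unit of the tracial ultraproduct tend to
one. -/
theorem tendsto_ntr_of_mk_eq_one {k : ℕ → ℕ} [∀ i, NeZero (k i)] {α : Ultrafilter ℕ}
    {x : boundedSeq k} (hx : TracialUltraproduct.mk α k x = 1) :
    Tendsto (fun i => ntr (x.1 i)) α (𝓝 1) := by
  have h : x - 1 ∈ traceIdeal α k := by
    rw [← TracialUltraproduct.mkₐ_eq_iff, map_one]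
    exact hx
  rw [mem_traceIdeal] at h
  have h2 : Tendsto (fun i => ntr (x.1 i) - 1) α (𝓝 0) := by
    have hs : Tendsto (fun i => √(hsSq ((x - 1).1 i))) α (𝓝 0) := by
      have := (Real.continuous_sqrt.tendsto 0).comp h
      rwa [Real.sqrt_zero] at this
    refine squeeze_zero_norm (fun i => ?_) hs
    have e : ntr (x.1 i) - 1 = ntr ((x - 1).1 i) := by
      have : (x - 1).1 i = x.1 i - 1 := rfl
      rw [this, ntr, ntr, Matrix.trace_sub, sub_div]
      congr 1
      exact ntr_one.symm
    rw [e]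
    exact Real.le_sqrt_of_sq_le (norm_ntr_sq_le _)
  simpa using h2.add_const 1

end TracialStab

end

noncomputable section
namespace TracialStab
open Filter Topology
open scoped ComplexOrder InnerProductSpace Matrix.Norms.L2Operator ENNReal

/-! ### The corner projection and the properties of the extension. -/

section DoubleUHF

variable {U : Type} [CStarAlgebra U] {σ : ∀ n, Mat (2 ^ n) →⋆ₐ[ℂ] U}
  (hinj : ∀ n, Function.Injective (σ n)) (hmono : Monotone fun n => Set.range (σ n))
  (hdense : Dense (⋃ n, Set.range (σ n)))

theorem uhfSystem_σ_apply (i : ℕ) (d : DoubleMat i) :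
    (uhfSystem σ hinj hmono hdense).σ i d = (σ i d.1, σ i d.2) := rfl

theorem uhfSystem_δ (i : ℕ) : (uhfSystem σ hinj hmono hdense).δ i = blockDiag (2 ^ i) := rfl

theorem uhfSystem_up_fst {n i : ℕ} (h : n ≤ i) :
    (uhfSystem σ hinj hmono hdense).up n i (1, 0) = (1, 0) := by
  apply (uhfSystem σ hinj hmono hdense).σ_injective i
  rw [ApproxSystem.σ_up _ h, uhfSystem_σ_apply, uhfSystem_σ_apply]
  simp

theorem uhfSystem_up_snd {n i : ℕ} (h : n ≤ i) :
    (uhfSystem σ hinj hmono hdense).up n i (0, 1) = (0, 1) := by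
  apply (uhfSystem σ hinj hmono hdense).σ_injective i
  rw [ApproxSystem.σ_up _ h, uhfSystem_σ_apply, uhfSystem_σ_apply]
  simp

/-- The extension of two copies of the UHF algebra. -/
abbrev DoubleUHF : Type := (uhfSystem σ hinj hmono hdense).Alg

/-- The projection onto the first half of each block. -/
def corner : DoubleUHF hinj hmono hdense := (uhfSystem σ hinj hmono hdense).tail 0 (1, 0)

theorem seq_corner (i : ℕ) :
    (uhfSystem σ hinj hmono hdense).seq (corner hinj hmono hdense) i =
      blockDiag (2 ^ i) (1, 0) := by
  rw [corner, ApproxSystem.seq_tail, uhfSystem_up_fst _ _ _ (Nat.zero_le i), uhfSystem_δ]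

theorem quot_corner :
    (uhfSystem σ hinj hmono hdense).quot (corner hinj hmono hdense) = (1, 0) := by
  rw [corner, ApproxSystem.quot_tail, uhfSystem_σ_apply]
  simp

/-- Traces on finite-dimensional quotients give the two halves the same weight. -/
theorem map_corner_eq {B : Type*} [Ring B] [Algebra ℂ B] [FiniteDimensional ℂ B]
    (θ : DoubleUHF hinj hmono hdense →ₙₐ[ℂ] B) (ρ : B →ₗ[ℂ] ℂ)
    (hρ : ∀ a b, ρ (a * b) = ρ (b * a)) :
    ρ (θ (corner hinj hmono hdense)) = ρ (θ (1 - corner hinj hmono hdense)) := by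
  set X := uhfSystem σ hinj hmono hdense with hX
  -- Since dim B = n < 2^n · 2^n, each of the two copies of M_{2^n} in the tail from n on is sent to
  -- 0.
  set n := Module.finrank ℂ B with hn
  have hlt : Module.finrank ℂ B < 2 ^ n * 2 ^ n :=
    (Nat.lt_two_pow_self).trans_le (Nat.le_mul_of_pos_left _ (by positivity))
  have htail : ∀ d : DoubleMat n, θ (X.tail n d) = 0 := by
    rintro ⟨a, b⟩
    have h1 := map_eq_zero_of_finrank_lt hlt
      ((θ.comp (X.tail n : DoubleMat n →ₙₐ[ℂ] X.Alg)).comp (NonUnitalAlgHom.inl ℂ _ _)) a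
    have h2 := map_eq_zero_of_finrank_lt hlt
      ((θ.comp (X.tail n : DoubleMat n →ₙₐ[ℂ] X.Alg)).comp (NonUnitalAlgHom.inr ℂ _ _)) b
    have h1 : θ (X.tail n (a, 0)) = 0 := h1
    have h2 : θ (X.tail n (0, b)) = 0 := h2
    have e : ((a, b) : DoubleMat n) = (a, 0) + (0, b) := by simp
    rw [e, map_add, map_add, h1, h2, add_zero]
  classical
  obtain ⟨C, hC⟩ : ∃ C, ∀ i,
      ‖(if i < n then blockSwap (2 ^ i) else 0 : Mat (blockSize i))‖ ≤ C := by
    refine ⟨∑ i ∈ Finset.range n, ‖blockSwap (2 ^ i)‖, fun i => ?_⟩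
    split_ifs with h
    · exact Finset.single_le_sum (f := fun i => ‖blockSwap (2 ^ i)‖) (fun i _ => norm_nonneg _)
        (Finset.mem_range.2 h)
    · rw [norm_zero]
      exact Finset.sum_nonneg fun i _ => norm_nonneg _
  -- The partial isometry swaps the halves of the first n blocks and is 0 beyond; having finite
  -- support, it is a null sequence and so lies in the algebra.
  obtain ⟨w, hw1, hw2⟩ := X.exists_of_tendsto
    (x := SeqAlg.mk (k := blockSize) (fun i => if i < n then blockSwap (2 ^ i) else 0) ⟨C, hC⟩)
    (tendsto_const_nhds.congr' (by
      filter_upwards [eventually_ge_atTop n] with i hi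
      simp [not_lt.2 hi]))
  have e1 : w * star w + X.tail n (1, 0) = corner hinj hmono hdense := by
    refine X.alg_ext (SeqAlg.ext fun i => ?_) ?_
    · rw [seq_corner, map_add, map_mul, map_star, hw1, SeqAlg.add_apply, SeqAlg.mul_apply,
        SeqAlg.star_apply, SeqAlg.mk_apply, X.seq_tail]
      by_cases hi : i < n
      · rw [if_pos hi, X.up_of_lt hi, map_zero, add_zero, blockSwap_mul_star]
      · rw [if_neg hi, zero_mul, zero_add, hX, uhfSystem_up_fst _ _ _ (not_lt.1 hi), uhfSystem_δ]
    · rw [quot_corner, map_add, map_mul, hw2, zero_mul, zero_add, X.quot_tail, hX,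
        uhfSystem_σ_apply]
      simp
  have hone : ∀ i, (1 : Mat (blockSize i)) - blockDiag (2 ^ i) (1, 0) =
      blockDiag (2 ^ i) (0, 1) := by
    intro i
    rw [← map_one (blockDiag (2 ^ i)), ← map_sub]
    congr 1
    ext1 <;> simp
  have e2 : star w * w + X.tail n (0, 1) = 1 - corner hinj hmono hdense := by
    refine X.alg_ext (SeqAlg.ext fun i => ?_) ?_
    · rw [map_sub, map_one, SeqAlg.sub_apply, SeqAlg.one_apply, seq_corner, hone, map_add, map_mul,
        map_star, hw1, SeqAlg.add_apply, SeqAlg.mul_apply, SeqAlg.star_apply, SeqAlg.mk_apply,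
        X.seq_tail]
      by_cases hi : i < n
      · rw [if_pos hi, X.up_of_lt hi, map_zero, add_zero, star_blockSwap_mul]
      · rw [if_neg hi, mul_zero, zero_add, hX, uhfSystem_up_snd _ _ _ (not_lt.1 hi), uhfSystem_δ]
    · rw [map_sub, map_one, quot_corner, map_add, map_mul, hw2, mul_zero, zero_add, X.quot_tail, hX,
        uhfSystem_σ_apply]
      ext1 <;> simp
  -- Only multiplicativity of θ is used; θ need be neither unital nor *-preserving.
  have h1 : θ (corner hinj hmono hdense) = θ w * θ (star w) := by
    rw [← e1, map_add, htail, add_zero, map_mul]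
  have h2 : θ (1 - corner hinj hmono hdense) = θ (star w) * θ w := by
    rw [← e2, map_add, htail, add_zero, map_mul]
  rw [h1, h2, hρ]

/-- Keeping θ(1) in place of 1 lets one argument serve both the unital and the non-unital category.
-/
theorem ntr_map_one {n : ℕ} (θ : DoubleUHF hinj hmono hdense →ₙₐ[ℂ] Mat n) :
    ntr (θ 1) = 2 * ntr (θ (corner hinj hmono hdense)) := by
  have h := map_corner_eq hinj hmono hdense θ (Matrix.traceLinearMap (Fin n) ℂ ℂ)
    fun a b => Matrix.trace_mul_comm a b
  simp only [Matrix.traceLinearMap_apply] at h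
  have e : (1 : DoubleUHF hinj hmono hdense) =
    corner hinj hmono hdense + (1 - corner hinj hmono hdense) := by abel
  rw [ntr, ntr, e, map_add, Matrix.trace_add, ← h]
  ring

/-- There are no families of finite-dimensional representations along which both the unit and
the corner have asymptotically full trace. -/
theorem not_tendsto_ntr {k : ℕ → ℕ} {α : Ultrafilter ℕ} {E : Set ℕ} (hE : E ∈ α)
    {p q : ∀ i, Mat (k i)}
    (h : ∀ i ∈ E, ∃ θ : DoubleUHF hinj hmono hdense →ₙₐ[ℂ] Mat (k i),
      p i = θ 1 ∧ q i = θ (corner hinj hmono hdense))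
    (hp : Tendsto (fun i => ntr (p i)) α (𝓝 1)) (hq : Tendsto (fun i => ntr (q i)) α (𝓝 1)) :
    False := by
  have h2 : Tendsto (fun i => ntr (p i)) α (𝓝 (2 * 1)) := by
    refine (hq.const_mul 2).congr' ?_
    filter_upwards [hE] with i hi
    obtain ⟨θ, h1, h2⟩ := h i hi
    rw [h1, h2, ntr_map_one]
  have := tendsto_nhds_unique hp h2
  norm_num at this

/-- Homomorphisms that vanish on null sequences give rise to homomorphisms that map the corner
to the unit. -/
theorem exists_hom_corner_eq_one {N : Type*} [Ring N] [Algebra ℂ N] [StarRing N]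
    (Q : SeqAlg blockSize →⋆ₐ[ℂ] N)
    (hQ : ∀ x : SeqAlg blockSize, Tendsto (fun i => ‖x i‖) atTop (𝓝 0) → Q x = 0) :
    ∃ φ : DoubleUHF hinj hmono hdense →⋆ₐ[ℂ] N, φ (corner hinj hmono hdense) = 1 := by
  set X := uhfSystem σ hinj hmono hdense with hX
  obtain ⟨F, -⟩ := exists_descend X.quot X.quot_surjective (Q.comp X.seq)
    fun a ha => hQ _ ((X.quot_eq_zero_iff a).1 ha)
  -- The map (u, v) ↦ (u, u) is unital and sends the image (1, 0) of the corner to 1.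
  let g : U × U →⋆ₐ[ℂ] U × U := (StarAlgHom.fst ℂ U U).prod (StarAlgHom.fst ℂ U U)
  refine ⟨(F.comp g).comp X.quot, ?_⟩
  change F (g (X.quot _)) = 1
  rw [quot_corner]
  exact map_one F

/-- The homomorphism to the tracial ultraproduct that factors through the first copy of the UHF
algebra. -/
theorem exists_hom_tracialUltraproduct {α : Ultrafilter ℕ} (hα : (α : Filter ℕ) ≤ cofinite) :
    ∃ φ : DoubleUHF hinj hmono hdense →⋆ₐ[ℂ] TracialUltraproduct α blockSize,
      φ (corner hinj hmono hdense) = 1 := by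
  refine exists_hom_corner_eq_one hinj hmono hdense
    ((TracialUltraproduct.mk α blockSize).comp (toBounded blockSize)) fun x hx => ?_
  have hx' : Tendsto (fun i => ‖x i‖ ^ 2) α (𝓝 0) := by
    rw [← Nat.cofinite_eq_atTop] at hx
    simpa using (hx.mono_left hα).pow 2
  have : toBounded blockSize x - 0 ∈ traceIdeal α blockSize := by
    rw [sub_zero, mem_traceIdeal]
    exact squeeze_zero (fun i => hsSq_nonneg _) (fun i => hsSq_le_norm_sq _) hx'
  have h := TracialUltraproduct.mkₐ_eq_iff.2 this
  rw [map_zero] at h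
  exact h

theorem not_matriciallyTraciallyStable :
    ¬ MatriciallyTraciallyStable (DoubleUHF hinj hmono hdense) := by
  intro H
  have hα : ((hyperfilter ℕ : Ultrafilter ℕ) : Filter ℕ) ≤ cofinite := hyperfilter_le_cofinite
  obtain ⟨φ, hφ⟩ := exists_hom_tracialUltraproduct hinj hmono hdense hα
  obtain ⟨E, hE, ψ, hψ⟩ := H _ hα blockSize (fun i => Nat.pos_of_ne_zero (NeZero.ne _)) φ
  obtain ⟨x, hx1, hx2⟩ := hψ 1
  obtain ⟨y, hy1, hy2⟩ := hψ (corner hinj hmono hdense)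
  rw [map_one] at hx2
  rw [hφ] at hy2
  exact not_tendsto_ntr hinj hmono hdense hE
    (fun i hi => ⟨(ψ i hi : _ →ₙₐ[ℂ] _), hx1 i hi, hy1 i hi⟩)
    (tendsto_ntr_of_mk_eq_one hx2) (tendsto_ntr_of_mk_eq_one hy2)

theorem not_matriciallyTraciallyStableNonUnital :
    ¬ MatriciallyTraciallyStableNonUnital (DoubleUHF hinj hmono hdense) := by
  intro H
  have hα : ((hyperfilter ℕ : Ultrafilter ℕ) : Filter ℕ) ≤ cofinite := hyperfilter_le_cofinite
  obtain ⟨φ, hφ⟩ := exists_hom_tracialUltraproduct hinj hmono hdense hα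
  obtain ⟨ψ, hψ⟩ := H _ hα blockSize (fun i => Nat.pos_of_ne_zero (NeZero.ne _))
    (φ : _ →⋆ₙₐ[ℂ] _)
  have h1 := (hψ 1).trans (map_one φ)
  have h2 := (hψ (corner hinj hmono hdense)).trans hφ
  let θ : ∀ i, DoubleUHF hinj hmono hdense →ₙₐ[ℂ] Mat (blockSize i) := fun i =>
    { toFun := fun a => (ψ a).1 i
      map_smul' := fun c a => by rw [map_smul]; rfl
      map_zero' := by rw [map_zero]; rfl
      map_add' := fun a b => by rw [map_add]; rfl
      map_mul' := fun a b => by rw [map_mul]; rfl }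
  exact not_tendsto_ntr hinj hmono hdense Filter.univ_mem (fun i _ => ⟨θ i, rfl, rfl⟩)
    (tendsto_ntr_of_mk_eq_one h1) (tendsto_ntr_of_mk_eq_one h2)

/-- The homomorphism to the von Neumann algebra ultraproduct that factors through the first copy
of the UHF algebra. -/
theorem exists_hom_ultraVN {α : Ultrafilter ℕ} (hα : (α : Filter ℕ) ≤ cofinite) :
    ∃ φ : DoubleUHF hinj hmono hdense →⋆ₐ[ℂ] (ultraVN blockSize α).toStarSubalgebra,
      φ (corner hinj hmono hdense) = 1 :=
  exists_hom_corner_eq_one hinj hmono hdense (ultraMk blockSize α) fun x hx =>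
    ultraMk_eq_zero_of_tendsto (by
      rw [← Nat.cofinite_eq_atTop] at hx
      exact hx.mono_left hα)

theorem tendsto_ntr_of_ultraMk_eq_one {k : ℕ → ℕ} [∀ i, NeZero (k i)] {α : Ultrafilter ℕ}
    {x : SeqAlg k} (hx : ultraMk k α x = 1) : Tendsto (fun i => ntr (x i)) α (𝓝 1) := by
  have h : limTr k α x = 1 := by
    rw [← inner_ultraMk, hx, ← map_one (ultraMk k α), inner_ultraMk, limTr_one]
  rw [← h]
  exact tendsto_limTr α x

/-- No homomorphism into the block diagonal operators lifts a homomorphism into the ultraproduct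
that maps both the unit and the corner to the unit. -/
theorem not_lift_ultraVN {α : Ultrafilter ℕ}
    (ψ : DoubleUHF hinj hmono hdense →⋆ₙₐ[ℂ] (blockVN blockSize).toStarSubalgebra)
    (h1 : ultraMk blockSize α (blocks blockSize (ψ 1)) = 1)
    (h2 : ultraMk blockSize α (blocks blockSize (ψ (corner hinj hmono hdense))) = 1) : False := by
  let θ : ∀ i, DoubleUHF hinj hmono hdense →ₙₐ[ℂ] Mat (blockSize i) := fun i =>
    { toFun := fun a => blocks blockSize (ψ a) i
      map_smul' := fun c a => by rw [map_smul, map_smul]; rfl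
      map_zero' := by rw [map_zero, map_zero]; rfl
      map_add' := fun a b => by rw [map_add, map_add]; rfl
      map_mul' := fun a b => by rw [map_mul, map_mul]; rfl }
  exact not_tendsto_ntr hinj hmono hdense (k := blockSize) (α := α) (E := Set.univ)
    (p := blocks blockSize (ψ 1)) (q := blocks blockSize (ψ (corner hinj hmono hdense)))
    Filter.univ_mem (fun i _ => ⟨θ i, rfl, rfl⟩)
    (tendsto_ntr_of_ultraMk_eq_one h1) (tendsto_ntr_of_ultraMk_eq_one h2)

/-- The unital notion of projectivity only allows nonzero target algebras. -/
theorem nontrivial_gns {k : ℕ → ℕ} [∀ i, NeZero (k i)] (α : Ultrafilter ℕ) :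
    Nontrivial (limTr k α).GNS := by
  refine ⟨gnsVec _ 1, 0, fun h => ?_⟩
  have := inner_gnsVec (limTr k α) 1 1
  rw [star_one, one_mul, limTr_one, h, inner_zero_left] at this
  exact zero_ne_one this

theorem not_wStarWStarProjective :
    ¬ WStarWStarProjective.{0, 0} (DoubleUHF hinj hmono hdense) := by
  intro H
  have hα : ((hyperfilter ℕ : Ultrafilter ℕ) : Filter ℕ) ≤ cofinite := hyperfilter_le_cofinite
  obtain ⟨φ, hφ⟩ := exists_hom_ultraVN hinj hmono hdense hα
  have := nontrivial_gns (k := blockSize) (hyperfilter ℕ)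
  obtain ⟨ψ, hψ⟩ := H _ _ (blockVN blockSize) (ultraVN blockSize (hyperfilter ℕ))
    ((ultraMk blockSize _).comp (blocks blockSize))
    ((ultraMk_surjective hα).comp (blocks_surjective blockSize)) φ
  refine not_lift_ultraVN hinj hmono hdense (α := hyperfilter ℕ) (ψ : _ →⋆ₙₐ[ℂ] _) ?_ ?_
  · exact (hψ 1).trans (map_one φ)
  · exact (hψ _).trans hφ

theorem not_wStarWStarProjectiveNonUnital :
    ¬ WStarWStarProjectiveNonUnital.{0, 0} (DoubleUHF hinj hmono hdense) := by
  intro H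
  have hα : ((hyperfilter ℕ : Ultrafilter ℕ) : Filter ℕ) ≤ cofinite := hyperfilter_le_cofinite
  obtain ⟨φ, hφ⟩ := exists_hom_ultraVN hinj hmono hdense hα
  obtain ⟨ψ, hψ⟩ := H _ _ (blockVN blockSize) (ultraVN blockSize (hyperfilter ℕ))
    ((ultraMk blockSize _).comp (blocks blockSize)).toNonUnitalStarAlgHom
    ((ultraMk_surjective hα).comp (blocks_surjective blockSize)) (φ : _ →⋆ₙₐ[ℂ] _)
  refine not_lift_ultraVN hinj hmono hdense (α := hyperfilter ℕ) ψ ?_ ?_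
  · exact (hψ 1).trans (map_one φ)
  · exact (hψ _).trans hφ

theorem isUHFTwoInfty (hinj : ∀ n, Function.Injective (σ n))
    (hmono : Monotone fun n => Set.range (σ n)) (hdense : Dense (⋃ n, Set.range (σ n))) :
    IsUHFTwoInfty U :=
  ⟨fun n => (σ n).range, hmono, fun n => ⟨(StarAlgEquiv.ofInjective (σ n) (hinj n)).symm⟩, hdense⟩

theorem isExtensionOfUHFByMatrices :
    IsExtensionOfUHFByMatrices (DoubleUHF hinj hmono hdense) := by
  set X := uhfSystem σ hinj hmono hdense
  refine ⟨blockSize, (toBounded blockSize).comp X.seq, U, inferInstance, X.quot,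
    fun i => Nat.pos_of_ne_zero (NeZero.ne _),
    (toBounded_bijective blockSize).1.comp X.seq_injective, fun x hx => ?_,
    isUHFTwoInfty hinj hmono hdense, X.quot_surjective, X.quot_eq_zero_iff⟩
  obtain ⟨y, rfl⟩ := (toBounded_bijective blockSize).2 x
  obtain ⟨a, rfl, -⟩ := X.exists_of_tendsto (x := y) hx
  exact ⟨a, rfl⟩

/-- Equal weights on p and 1 - p, with total weight 1. -/
theorem apply_corner_of_mem_finDimTraces {τ : WeakDual ℂ (DoubleUHF hinj hmono hdense)}
    (hτ : τ ∈ finDimTraces (DoubleUHF hinj hmono hdense)) :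
    τ (corner hinj hmono hdense) = 1 / 2 := by
  obtain ⟨B, _, _, θ, ρ, hρ, h⟩ := hτ
  have h1 := map_corner_eq hinj hmono hdense (θ : _ →ₙₐ[ℂ] B) (WeakDual.toStrongDual ρ).toLinearMap
    hρ.comm
  have h1 : ρ (θ (corner hinj hmono hdense)) = ρ (θ (1 - corner hinj hmono hdense)) := h1
  rw [map_sub, map_one, map_sub, hρ.map_one] at h1
  rw [h]
  linear_combination h1 / 2

/-- The vector state at the unit vector, pulled back along φ. Every φ a has a representing sequence,
on which this state is the limit trace; positivity and traciality are inherited from there. -/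
theorem exists_tracialState : ∃ τ : WeakDual ℂ (DoubleUHF hinj hmono hdense),
    IsTracialState τ ∧ τ (corner hinj hmono hdense) = 1 := by
  have hα : ((hyperfilter ℕ : Ultrafilter ℕ) : Filter ℕ) ≤ cofinite := hyperfilter_le_cofinite
  obtain ⟨φ, hφ⟩ := exists_hom_ultraVN hinj hmono hdense hα
  set f := limTr blockSize (hyperfilter ℕ) with hf
  let φ' : DoubleUHF hinj hmono hdense →⋆ₐ[ℂ] (f.GNS →L[ℂ] f.GNS) :=
    (StarSubalgebra.subtype _).comp φ
  let Φ : DoubleUHF hinj hmono hdense →L[ℂ] (f.GNS →L[ℂ] f.GNS) :=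
    φ'.toAlgHom.toLinearMap.mkContinuous 1 fun a => by
      rw [one_mul]
      exact NonUnitalStarAlgHom.norm_apply_le φ' a
  let τ : WeakDual ℂ (DoubleUHF hinj hmono hdense) := StrongDual.toWeakDual
    ((innerSL ℂ (gnsVec f 1)) ∘L (ContinuousLinearMap.apply ℂ f.GNS (gnsVec f 1)) ∘L Φ)
  have hτ : ∀ a x, ultraMk blockSize (hyperfilter ℕ) x = φ a → τ a = f x := by
    intro a x hx
    rw [hf, ← inner_ultraMk, hx]
    rfl
  have hone : ∀ a, φ a = 1 → τ a = 1 := fun a ha => by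
    rw [hτ a 1 (by rw [map_one, ha]), hf, limTr_one]
  refine ⟨τ, ⟨hone 1 (map_one φ), fun a => ?_, fun a b => ?_⟩, hone _ hφ⟩
  · obtain ⟨x, hx⟩ := ultraMk_surjective hα (φ a)
    rw [hτ _ (star x * x) (by rw [map_mul, map_mul, map_star, map_star, hx])]
    exact f.map_nonneg (star_mul_self_nonneg x)
  · obtain ⟨x, hx⟩ := ultraMk_surjective hα (φ a)
    obtain ⟨y, hy⟩ := ultraMk_surjective hα (φ b)
    rw [hτ _ (x * y) (by rw [map_mul, map_mul, hx, hy]),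
      hτ _ (y * x) (by rw [map_mul, map_mul, hx, hy])]
    exact limTr_isTracial _ x y

/-- Evaluation at the corner is weak*-continuous, so it stays equal to 1/2 on the closure. -/
theorem exists_tracialState_notMem_closure :
    ∃ τ : WeakDual ℂ (DoubleUHF hinj hmono hdense), IsTracialState τ ∧
      τ ∉ closure (finDimTraces (DoubleUHF hinj hmono hdense)) := by
  obtain ⟨τ, hτ, h1⟩ := exists_tracialState hinj hmono hdense
  refine ⟨τ, hτ, fun hcl => ?_⟩
  have hclosed : IsClosed {ρ : WeakDual ℂ (DoubleUHF hinj hmono hdense) |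
      ρ (corner hinj hmono hdense) = 1 / 2} :=
    isClosed_eq (WeakDual.eval_continuous _) continuous_const
  have h2 : τ (corner hinj hmono hdense) = 1 / 2 :=
    closure_minimal (fun ρ hρ => apply_corner_of_mem_finDimTraces hinj hmono hdense hρ) hclosed hcl
  rw [h1] at h2
  norm_num at h2

theorem isAF_doubleUHF : IsAF (DoubleUHF hinj hmono hdense) :=
  (uhfSystem σ hinj hmono hdense).isAF

theorem isRFD_doubleUHF : IsRFD (DoubleUHF hinj hmono hdense) :=
  (uhfSystem σ hinj hmono hdense).isRFD

end DoubleUHF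

end TracialStab

end

theorem theorem5p5 :
    ∃ (A : Type) (_ : CStarAlgebra A),
      TracialStab.IsAF A ∧ TracialStab.IsRFD A ∧
      ¬ TracialStab.MatriciallyTraciallyStable A ∧
      ¬ TracialStab.MatriciallyTraciallyStableNonUnital A ∧
      ¬ TracialStab.WStarWStarProjective.{0, 0} A ∧
      ¬ TracialStab.WStarWStarProjectiveNonUnital.{0, 0} A ∧
      TracialStab.IsExtensionOfUHFByMatrices A ∧
      ∃ τ : WeakDual ℂ A, TracialStab.IsTracialState τ ∧
        τ ∉ closure (TracialStab.finDimTraces A) := by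
  obtain ⟨U, _, σ, hinj, hmono, hdense⟩ := TracialStab.exists_uhf
  exact ⟨TracialStab.DoubleUHF hinj hmono hdense, inferInstance,
    TracialStab.isAF_doubleUHF hinj hmono hdense, TracialStab.isRFD_doubleUHF hinj hmono hdense,
    TracialStab.not_matriciallyTraciallyStable hinj hmono hdense,
    TracialStab.not_matriciallyTraciallyStableNonUnital hinj hmono hdense,
    TracialStab.not_wStarWStarProjective hinj hmono hdense,
    TracialStab.not_wStarWStarProjectiveNonUnital hinj hmono hdense,
    TracialStab.isExtensionOfUHFByMatrices hinj hmono hdense,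
    TracialStab.exists_tracialState_notMem_closure hinj hmono hdense⟩
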